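/- All manifolds are finite-dimensional, Hausdorff, second countable, smooth, and of constant dimension. A *Lie category* $\mathcal C\rightrightarrows\mathcal X$ is a small category whose set of morphisms $\mathcal C$ is a smooth manifold with or without boundary and whose set of objects $\mathcal X$ is a smooth manifold without boundary, such that the source and target maps $s,t\colon\mathcal C\to\mathcal X$ are smooth submersions, their restrictions $\partial\mathcal C\to\mathcal X$ to the boundary are submersions as well, and the unit map $x\mapsto 1_x$ and the composition map $(g,h)\mapsto gh$, defined on $\{(g,h)\in\mathcal C\times\mathcal C : s(g)=t(h)\}$, are smooth. A *Lie groupoid* is a Lie category all of whose morphisms are invertible. A Lie category $\mathcal C\rightrightarrows\mathcal X$ is *extendable to a Lie groupoid* if there are a Lie groupoid $\mathcal G\rightrightarrows\mathcal X$ over the same manifold of objects and a functor $F\colon\mathcal C\to\mathcal G$, the identity on objects, that is injective and an immersion (smooth with injective differential at every point). A subset $S$ of a manifold $M$ with or without boundary is an *embedded submanifold* if, with the subspace topology, it carries the structure of a smooth manifold with or without boundary such that around each point of $S$ there are charts of $S$ and of $M$ in which the inclusion $S\hookrightarrow M$ is the restriction of an injective affine map. A *Lie monoid* is a monoid that is a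 smooth manifold with or without boundary and whose multiplication is smooth. **Corollary.** Let $\mathcal C\rightrightarrows\mathcal X$ be a Lie category that is extendable to a Lie groupoid. Then for all $x,y\in\mathcal X$ the set $\mathcal C_x^y=\{g\in\mathcal C : s(g)=x,\ t(g)=y\}$ of morphisms from $x$ to $y$ is a closed subset and an embedded submanifold of $\mathcal C$ (possibly empty). In particular, for every $x\in\mathcal X$ the monoid $\mathcal C_x^x$, with composition as multiplication and with its structure of embedded submanifold of $\mathcal C$, is a Lie monoid. -/

import Mathlib

open scoped Manifold ContDiff Topology
open Set

universe w

/-! ### Smooth manifolds with or without boundary -/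

/-- `I` models manifolds with or without boundary: its range is the whole model vector space or a
closed half-space `{v | 0 ≤ ℓ v}` of it, `ℓ ≠ 0`. (Corners are excluded.) -/
def IsBoundaryModel {E : Type*} [NormedAddCommGroup E] [NormedSpace ℝ E]
    {H : Type*} [TopologicalSpace H] (I : ModelWithCorners ℝ E H) : Prop :=
  range I = univ ∨ ∃ ℓ : E →L[ℝ] ℝ, ℓ ≠ 0 ∧ range I = {v | 0 ≤ ℓ v}

/-- `M` is a finite-dimensional (Hausdorff, second countable) smooth manifold with or without
boundary, modelled on `I`. -/
structure IsSmoothManifold {E : Type*} [NormedAddCommGroup E] [NormedSpace ℝ E]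
    {H : Type*} [TopologicalSpace H] (I : ModelWithCorners ℝ E H)
    (M : Type*) [TopologicalSpace M] [ChartedSpace H M] : Prop where
  finiteDimensional : FiniteDimensional ℝ E
  boundaryModel : IsBoundaryModel I
  t2Space : T2Space M
  secondCountable : SecondCountableTopology M
  isManifold : IsManifold I ∞ M

/-- Smooth submersion: smooth, with surjective differential at every point. -/
def IsSmoothSubmersion {E : Type*} [NormedAddCommGroup E] [NormedSpace ℝ E]
    {H : Type*} [TopologicalSpace H] (I : ModelWithCorners ℝ E H)
    {E' : Type*} [NormedAddCommGroup E'] [NormedSpace ℝ E']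
    {H' : Type*} [TopologicalSpace H'] (J : ModelWithCorners ℝ E' H')
    {M : Type*} [TopologicalSpace M] [ChartedSpace H M]
    {N : Type*} [TopologicalSpace N] [ChartedSpace H' N] (f : M → N) : Prop :=
  ContMDiff I J ∞ f ∧ ∀ p : M, Function.Surjective (mfderiv I J f p)

/-- Smooth immersion: smooth, with injective differential at every point. -/
def IsSmoothImmersion {E : Type*} [NormedAddCommGroup E] [NormedSpace ℝ E]
    {H : Type*} [TopologicalSpace H] (I : ModelWithCorners ℝ E H)
    {E' : Type*} [NormedAddCommGroup E'] [NormedSpace ℝ E']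
    {H' : Type*} [TopologicalSpace H'] (J : ModelWithCorners ℝ E' H')
    {M : Type*} [TopologicalSpace M] [ChartedSpace H M]
    {N : Type*} [TopologicalSpace N] [ChartedSpace H' N] (f : M → N) : Prop :=
  ContMDiff I J ∞ f ∧ ∀ p : M, Function.Injective (mfderiv I J f p)

/-- The restriction of the smooth map `f : M → N` to `∂M` is a submersion. When `M` is modelled on
the half-space `{0 ≤ ℓ}` and `p ∈ ∂M`, the preferred chart at `p`, through which `T_p M` is
identified with `E`, maps `∂M` to the hyperplane `{ℓ = 0}`, so that `T_p (∂M) = ker ℓ`. (When `M`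
is modelled on a whole vector space, `∂M` is empty and there is no condition.) -/
def IsSubmersionOnBoundary {E : Type*} [NormedAddCommGroup E] [NormedSpace ℝ E]
    {H : Type*} [TopologicalSpace H] (I : ModelWithCorners ℝ E H)
    {E' : Type*} [NormedAddCommGroup E'] [NormedSpace ℝ E']
    {H' : Type*} [TopologicalSpace H'] (J : ModelWithCorners ℝ E' H')
    {M : Type*} [TopologicalSpace M] [ChartedSpace H M]
    {N : Type*} [TopologicalSpace N] [ChartedSpace H' N] (f : M → N) : Prop :=
  ∀ ℓ : E →L[ℝ] ℝ, ℓ ≠ 0 → range I = {v | 0 ≤ ℓ v} →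
    ∀ p ∈ I.boundary M, ∀ w : TangentSpace J (f p),
      ∃ v : E, ℓ v = 0 ∧ mfderiv I J f p (v : TangentSpace I p) = w

/-! ### Embedded submanifolds -/

/-- A structure of embedded submanifold on the subset `S` of `M`: with the subspace topology, `S`
is a smooth manifold with or without boundary, and around each point there are charts of `S` and of
`M` in which the inclusion is the restriction of an injective affine map. Equivalently, around each
point of `S` there is a chart of `M` which maps `S` onto a relatively open piece of an affine
subspace, or of a closed half-space of an affine subspace, of the model vector space.
(Affine maps rather than linear ones, since charts are not required to be centred: an interior
point of a manifold with boundary has no chart to the half-space `{0 ≤ ℓ}` that maps it to `0`.) -/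
structure EmbeddedSubmanifold {E : Type*} [NormedAddCommGroup E] [NormedSpace ℝ E]
    {H : Type*} [TopologicalSpace H] (I : ModelWithCorners ℝ E H)
    {M : Type*} [TopologicalSpace M] [ChartedSpace H M] (S : Set M) where
  /-- the dimension -/
  dim : ℕ
  /-- the model space -/
  Model : Type
  [topModel : TopologicalSpace Model]
  /-- the model with corners -/
  model : ModelWithCorners ℝ (EuclideanSpace ℝ (Fin dim)) Model
  [charted : ChartedSpace Model S]
  isSmoothManifold : IsSmoothManifold model S
  adapted : ∀ p : S,
    ∃ φ ∈ IsManifold.maximalAtlas model ∞ S, ∃ ψ ∈ IsManifold.maximalAtlas I ∞ M,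
    ∃ A : EuclideanSpace ℝ (Fin dim) →ᵃ[ℝ] E,
      p ∈ φ.source ∧ MapsTo (Subtype.val : S → M) φ.source ψ.source ∧ Function.Injective A ∧
      EqOn (ψ.extend I ∘ (Subtype.val : S → M) ∘ (φ.extend model).symm) A (φ.extend model).target

attribute [instance] EmbeddedSubmanifold.topModel EmbeddedSubmanifold.charted

/-- The subset `S` of `M` is an embedded submanifold. -/
def IsEmbeddedSubmanifold {E : Type*} [NormedAddCommGroup E] [NormedSpace ℝ E]
    {H : Type*} [TopologicalSpace H] (I : ModelWithCorners ℝ E H)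
    {M : Type*} [TopologicalSpace M] [ChartedSpace H M] (S : Set M) : Prop :=
  Nonempty (EmbeddedSubmanifold I S)

/-- A Lie monoid: a monoid which is a smooth manifold with or without boundary, with smooth
multiplication. -/
def IsLieMonoid {E : Type*} [NormedAddCommGroup E] [NormedSpace ℝ E]
    {H : Type*} [TopologicalSpace H] (I : ModelWithCorners ℝ E H)
    (M : Type*) [TopologicalSpace M] [ChartedSpace H M] [Monoid M] : Prop :=
  IsSmoothManifold I M ∧ ContMDiffMul I ∞ M

/-! ### Lie categories -/

/-- A small category with set of morphisms `C` and set of objects `X`; `comp g h` is the composite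
`g h` ("`g` after `h`"), defined when the source of `g` is the target of `h`. -/
structure CategoryStructure (C X : Type*) where
  /-- source -/
  src : C → X
  /-- target -/
  tgt : C → X
  /-- units -/
  unit : X → C
  /-- composition -/
  comp : ∀ g h : C, src g = tgt h → C
  src_unit : ∀ x, src (unit x) = x
  tgt_unit : ∀ x, tgt (unit x) = x
  src_comp : ∀ g h (e : src g = tgt h), src (comp g h e) = src h
  tgt_comp : ∀ g h (e : src g = tgt h), tgt (comp g h e) = tgt g
  unit_comp : ∀ g, comp (unit (tgt g)) g (src_unit (tgt g)) = g
  comp_unit : ∀ g, comp g (unit (src g)) (tgt_unit (src g)).symm = g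
  assoc : ∀ g h k (e : src g = tgt h) (e' : src h = tgt k),
    comp (comp g h e) k ((src_comp g h e).trans e') =
      comp g (comp h k e') (e.trans (tgt_comp h k e').symm)

namespace CategoryStructure

/-- The set of composable pairs. -/
def composable {C X : Type*} (𝒞 : CategoryStructure C X) : Set (C × C) :=
  {p | 𝒞.src p.1 = 𝒞.tgt p.2}

open Classical in
/-- The composition map, extended arbitrarily to non-composable pairs; it is used only on the set
of composable pairs. -/
noncomputable def compMap {C X : Type*} (𝒞 : CategoryStructure C X) (p : C × C) : C :=
  if e : 𝒞.src p.1 = 𝒞.tgt p.2 then 𝒞.comp p.1 p.2 e else p.1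

/-- The set of morphisms from `x` to `y`. -/
def homSet {C X : Type*} (𝒞 : CategoryStructure C X) (x y : X) : Set C :=
  {g | 𝒞.src g = x ∧ 𝒞.tgt g = y}

/-- The endomorphisms of `x` form a monoid under composition. -/
instance isotropyMonoid {C X : Type*} (𝒞 : CategoryStructure C X) (x : X) :
    Monoid (𝒞.homSet x x) where
  mul g h := ⟨𝒞.comp g.1 h.1 (g.2.1.trans h.2.2.symm),
    (𝒞.src_comp _ _ _).trans h.2.1, (𝒞.tgt_comp _ _ _).trans g.2.2⟩
  one := ⟨𝒞.unit x, 𝒞.src_unit x, 𝒞.tgt_unit x⟩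
  mul_assoc g h k := Subtype.ext (𝒞.assoc g.1 h.1 k.1 _ _)
  one_mul := by
    rintro ⟨g, hs, rfl⟩
    exact Subtype.ext (𝒞.unit_comp g)
  mul_one := by
    rintro ⟨g, rfl, ht⟩
    exact Subtype.ext (𝒞.comp_unit g)

/-- Every morphism is invertible. -/
def IsGroupoid {C X : Type*} (𝒞 : CategoryStructure C X) : Prop :=
  ∀ g, ∃ (g' : C) (e : 𝒞.src g = 𝒞.tgt g') (e' : 𝒞.src g' = 𝒞.tgt g),
    𝒞.comp g g' e = 𝒞.unit (𝒞.tgt g) ∧ 𝒞.comp g' g e' = 𝒞.unit (𝒞.src g)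

/-- `F` is (the map on morphisms of) a functor that is the identity on objects. -/
structure IsFunctorOverId {C D X : Type*} (𝒞 : CategoryStructure C X) (𝒟 : CategoryStructure D X)
    (F : C → D) : Prop where
  src_map : ∀ g, 𝒟.src (F g) = 𝒞.src g
  tgt_map : ∀ g, 𝒟.tgt (F g) = 𝒞.tgt g
  map_unit : ∀ x, F (𝒞.unit x) = 𝒟.unit x
  map_comp : ∀ g h (e : 𝒞.src g = 𝒞.tgt h),
    F (𝒞.comp g h e) = 𝒟.comp (F g) (F h) ((src_map g).trans (e.trans (tgt_map h).symm))

/-- Lie categories: `C` is a smooth manifold with or without boundary, `X` an `m`-dimensional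
smooth manifold without boundary, source and target are smooth submersions whose restrictions to
`∂C` are submersions too, and units and composition are smooth. Smoothness of the composition
is smoothness on the subset (a submanifold with corners) of composable pairs of `C × C`. -/
structure IsLieCategory {E : Type*} [NormedAddCommGroup E] [NormedSpace ℝ E]
    {H : Type*} [TopologicalSpace H] (I : ModelWithCorners ℝ E H) (m : ℕ)
    {C : Type*} [TopologicalSpace C] [ChartedSpace H C]
    {X : Type*} [TopologicalSpace X] [ChartedSpace (EuclideanSpace ℝ (Fin m)) X]
    (𝒞 : CategoryStructure C X) : Prop where
  isSmoothManifold : IsSmoothManifold I C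
  isSmoothManifold_base : IsSmoothManifold (𝓡 m) X
  src_submersion : IsSmoothSubmersion I (𝓡 m) 𝒞.src
  tgt_submersion : IsSmoothSubmersion I (𝓡 m) 𝒞.tgt
  src_submersion_boundary : IsSubmersionOnBoundary I (𝓡 m) 𝒞.src
  tgt_submersion_boundary : IsSubmersionOnBoundary I (𝓡 m) 𝒞.tgt
  unit_smooth : ContMDiff (𝓡 m) I ∞ 𝒞.unit
  comp_smooth : ContMDiffOn (I.prod I) I ∞ 𝒞.compMap 𝒞.composable

/-- The Lie category `𝒞` is extendable to a Lie groupoid: there are a Lie groupoid `𝒢` over the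
same manifold of objects (a Lie category in which every morphism is invertible) and an injective,
immersive functor from `𝒞` to `𝒢` over the identity. -/
def IsExtendable.{v, uE, uH, uC, uX} {E : Type uE} [NormedAddCommGroup E] [NormedSpace ℝ E]
    {H : Type uH} [TopologicalSpace H] (I : ModelWithCorners ℝ E H) (m : ℕ)
    {C : Type uC} [TopologicalSpace C] [ChartedSpace H C]
    {X : Type uX} [TopologicalSpace X] [ChartedSpace (EuclideanSpace ℝ (Fin m)) X]
    (𝒞 : CategoryStructure C X) : Prop :=
  ∃ (E' : Type v) (_ : NormedAddCommGroup E') (_ : NormedSpace ℝ E')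
    (H' : Type v) (_ : TopologicalSpace H') (I' : ModelWithCorners ℝ E' H')
    (G : Type v) (_ : TopologicalSpace G) (_ : ChartedSpace H' G)
    (𝒢 : CategoryStructure G X) (F : C → G),
    𝒢.IsLieCategory I' m ∧ 𝒢.IsGroupoid ∧
    𝒞.IsFunctorOverId 𝒢 F ∧ Function.Injective F ∧ IsSmoothImmersion I I' F

end CategoryStructure

/-! ### Half-spaces -/

section HalfSpace

variable {E : Type*} [NormedAddCommGroup E] [NormedSpace ℝ E]
  {F : Type*} [NormedAddCommGroup F] [NormedSpace ℝ F]

theorem convex_halfSpace (ℓ : E →L[ℝ] ℝ) : Convex ℝ {v | 0 ≤ ℓ v} :=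
  convex_halfSpace_ge ℓ.isLinear 0

theorem exists_inward (ℓ : E →L[ℝ] ℝ) : ∃ e : E, ℓ = 0 ∨ ℓ e = 1 := by
  by_cases h : ℓ = 0
  · exact ⟨0, Or.inl h⟩
  · obtain ⟨v, hv⟩ : ∃ v, ℓ v ≠ 0 := by
      by_contra! hc
      exact h (ContinuousLinearMap.ext hc)
    exact ⟨(ℓ v)⁻¹ • v, Or.inr (by simp [hv])⟩

theorem interior_halfSpace_nonempty (ℓ : E →L[ℝ] ℝ) : (interior {v | 0 ≤ ℓ v}).Nonempty := by
  obtain ⟨e, rfl | he⟩ := exists_inward ℓ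
  · exact ⟨0, by simp⟩
  · refine ⟨e, mem_interior.2 ⟨{v | 0 < ℓ v}, fun v hv => (show 0 < ℓ v from hv).le,
      isOpen_lt continuous_const ℓ.continuous, by simp [he]⟩⟩

theorem uniqueDiffOn_halfSpace_inter (ℓ : E →L[ℝ] ℝ) {U : Set E} (hU : IsOpen U) :
    UniqueDiffOn ℝ ({v | 0 ≤ ℓ v} ∩ U) :=
  (uniqueDiffOn_convex (convex_halfSpace ℓ) (interior_halfSpace_nonempty ℓ)).inter hU

/-- A Lipschitz retraction onto a half-space, along a transversal direction. -/
theorem exists_lipschitz_retraction (ℓ : E →L[ℝ] ℝ) :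
    ∃ (ρ : E → E) (C : NNReal), LipschitzWith C ρ ∧ (∀ x, 0 ≤ ℓ (ρ x)) ∧
      ∀ x, 0 ≤ ℓ x → ρ x = x := by
  obtain ⟨e, h⟩ := exists_inward ℓ
  have h1 : LipschitzWith ‖ℓ‖₊ (fun x => max (-ℓ x) 0) :=
    (ℓ.lipschitz.neg).max_const 0
  have h2 : LipschitzWith ‖e‖₊ (fun r : ℝ => r • e) :=
    LipschitzWith.of_dist_le_mul fun a b => by
      rw [dist_eq_norm, ← sub_smul, norm_smul, mul_comm, dist_eq_norm]; rfl
  refine ⟨fun x => x + max (-ℓ x) 0 • e, _, LipschitzWith.id.add (h2.comp h1), fun x => ?_,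
    fun x hx => by simp [hx]⟩
  rcases h with rfl | he
  · simp
  · have : -ℓ x ≤ max (-ℓ x) 0 := le_max_left _ _
    simp only [map_add, map_smul, smul_eq_mul, he]
    linarith

theorem exists_continuousLinearEquiv_of_norm_sub_id_lt [FiniteDimensional ℝ E] (D : E →L[ℝ] E)
    {c : ℝ} (hc : c < 1) (h : ‖D - ContinuousLinearMap.id ℝ E‖ ≤ c) :
    ∃ A : E ≃L[ℝ] E, (A : E →L[ℝ] E) = D := by
  have hinj : Function.Injective (D : E →ₗ[ℝ] E) := by
    rw [← LinearMap.ker_eq_bot, LinearMap.ker_eq_bot']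
    intro v hv
    have h1 : ‖(D - ContinuousLinearMap.id ℝ E) v‖ ≤ c * ‖v‖ :=
      ContinuousLinearMap.le_of_opNorm_le _ h v
    have h2 : (D - ContinuousLinearMap.id ℝ E) v = -v := by
      have : D v = 0 := hv
      simp [this]
    rw [h2, norm_neg] at h1
    by_contra hne
    have := norm_pos_iff.2 hne
    nlinarith
  exact ⟨(LinearEquiv.ofInjectiveEndo (D : E →ₗ[ℝ] E) hinj).toContinuousLinearEquiv, by
    ext v; rfl⟩

/-- The derivative of a smooth map on a relatively open piece of a half-space which is tangent to
the identity is close to the identity near the point. -/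
theorem exists_ball_norm_fderivWithin_sub_id_le (ℓ : E →L[ℝ] ℝ) {U : Set E} (hU : IsOpen U) {p : E}
    (hp : 0 ≤ ℓ p) (hpU : p ∈ U) {θ : E → E} (hθ : ContDiffOn ℝ ∞ θ ({v | 0 ≤ ℓ v} ∩ U))
    (hd : HasFDerivWithinAt θ (ContinuousLinearMap.id ℝ E) {v | 0 ≤ ℓ v} p)
    {c : ℝ} (hc : 0 < c) :
    ∃ r > 0, Metric.ball p r ⊆ U ∧ ∀ z ∈ {v | 0 ≤ ℓ v} ∩ Metric.ball p r,
      ‖fderivWithin ℝ θ ({v | 0 ≤ ℓ v} ∩ U) z - ContinuousLinearMap.id ℝ E‖ ≤ c := by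
  have hu := uniqueDiffOn_halfSpace_inter ℓ hU
  have hp' : p ∈ {v | 0 ≤ ℓ v} ∩ U := ⟨hp, hpU⟩
  have hcont := hθ.continuousOn_fderivWithin hu (by simp) p hp'
  have hdp : fderivWithin ℝ θ ({v | 0 ≤ ℓ v} ∩ U) p = ContinuousLinearMap.id ℝ E :=
    (hd.mono inter_subset_left).fderivWithin (hu p hp')
  have hev := Metric.tendsto_nhds.1 hcont c hc
  rw [eventually_nhdsWithin_iff] at hev
  obtain ⟨r, hr, hball⟩ := Metric.eventually_nhds_iff_ball.1 (hev.and (hU.mem_nhds hpU))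
  refine ⟨r, hr, fun z hz => (hball z hz).2, fun z hz => ?_⟩
  have := (hball z hz.2).1 ⟨hz.1, (hball z hz.2).2⟩
  rw [hdp, dist_eq_norm] at this
  exact this.le

/-- If `f` is smooth on a relatively open piece of a half-space and has invertible derivatives,
then its continuous local inverse is smooth. -/
theorem contDiffOn_symm_of_invertible [FiniteDimensional ℝ E] {s t : Set E}
    (hs : UniqueDiffOn ℝ s) (ht : UniqueDiffOn ℝ t) {f g : E → E} (hf : ContDiffOn ℝ ∞ f s)
    (hg : MapsTo g t s)
    (A : E → E ≃L[ℝ] E) (hA : ∀ z ∈ s, HasFDerivWithinAt f (A z : E →L[ℝ] E) s z)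
    (hB : ∀ y ∈ t, HasFDerivWithinAt g ((A (g y)).symm : E →L[ℝ] E) t y) :
    ContDiffOn ℝ ∞ g t := by
  have hfd : ContDiffOn ℝ ∞ (fderivWithin ℝ f s) s :=
    ((contDiffOn_infty_iff_fderivWithin hs).1 hf).2
  have key : ∀ n : ℕ, ContDiffOn ℝ n g t := by
    intro n
    induction n with
    | zero => exact contDiffOn_zero.2 fun y hy => (hB y hy).continuousWithinAt
    | succ n ih =>
      have : ContDiffOn ℝ ((n : ℕ∞) + 1) g t := by
        refine (contDiffOn_succ_iff_fderivWithin ht).2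
          ⟨fun y hy => (hB y hy).differentiableWithinAt, by simp, ?_⟩
        have h1 : ContDiffOn ℝ n (fun y => ContinuousLinearMap.inverse
            (fderivWithin ℝ f s (g y))) t := by
          intro y hy
          have h2 : fderivWithin ℝ f s (g y) = A (g y) := (hA _ (hg hy)).fderivWithin (hs _ (hg hy))
          have h3 : ContDiffAt ℝ n ContinuousLinearMap.inverse (fderivWithin ℝ f s (g y)) := by
            rw [h2]; exact contDiffAt_map_inverse _
          exact h3.comp_contDiffWithinAt (x := y) (f := fun y => fderivWithin ℝ f s (g y))
            ((hfd.of_le (by exact_mod_cast le_top)).comp ih hg y hy)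
        refine h1.congr fun y hy => ?_
        rw [(hB y hy).fderivWithin (ht y hy), (hA _ (hg hy)).fderivWithin (hs _ (hg hy)),
          ContinuousLinearMap.inverse_equiv]
      exact_mod_cast this
  exact contDiffOn_infty.2 key

/-- The inverse function theorem in a half-space, for maps tangent to the identity. -/
theorem exists_straightening [FiniteDimensional ℝ E] (ℓ : E →L[ℝ] ℝ) {U : Set E} (hU : IsOpen U)
    {p : E} (hp : 0 ≤ ℓ p) (hpU : p ∈ U) {θ : E → E}
    (hθ : ContDiffOn ℝ ∞ θ ({v | 0 ≤ ℓ v} ∩ U))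
    (hd : HasFDerivWithinAt θ (ContinuousLinearMap.id ℝ E) {v | 0 ≤ ℓ v} p) (hθp : θ p = p)
    (hℓ : ℓ p = 0 → ∀ z ∈ {v | 0 ≤ ℓ v} ∩ U, ℓ (θ z) = ℓ z) :
    ∃ e : OpenPartialHomeomorph E E, e.source ⊆ U ∧ p ∈ e.source ∧
      EqOn e θ ({v | 0 ≤ ℓ v} ∩ e.source) ∧ (∀ z ∈ e.source, 0 ≤ ℓ (e z) ↔ 0 ≤ ℓ z) ∧
      ContDiffOn ℝ ∞ e.symm ({v | 0 ≤ ℓ v} ∩ e.target) ∧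
      ∀ z ∈ {v | 0 ≤ ℓ v} ∩ e.source, ∃ A : E ≃L[ℝ] E,
        HasFDerivWithinAt θ (A : E →L[ℝ] E) {v | 0 ≤ ℓ v} z ∧
        HasFDerivWithinAt e.symm (A.symm : E →L[ℝ] E) {v | 0 ≤ ℓ v} (e z) := by
  obtain ⟨ρ, C, hρ, hρQ, hρid⟩ := exists_lipschitz_retraction ℓ
  set Q : Set E := {v | 0 ≤ ℓ v} with hQ
  obtain ⟨c, hc0, hc1, hcC⟩ : ∃ c : NNReal, 0 < c ∧ c < 1 ∧ c * C ≤ 1 / 2 := by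
    refine ⟨1 / (2 * (C + 1)), by positivity, ?_, ?_⟩
    · rw [div_lt_one (by positivity)]
      calc (1 : NNReal) < 2 * 1 := by norm_num
        _ ≤ 2 * (C + 1) := by gcongr; simp
    · rw [div_mul_eq_mul_div, one_mul, div_le_div_iff₀ (by positivity) (by positivity), one_mul,
        mul_comm]
      gcongr; simp
  obtain ⟨r, hr, hrU, hrc⟩ := exists_ball_norm_fderivWithin_sub_id_le ℓ hU hp hpU hθ hd
    (NNReal.coe_pos.2 hc0)
  have hu := uniqueDiffOn_halfSpace_inter ℓ hU
  have hD : ∀ z ∈ Q ∩ U, HasFDerivWithinAt θ (fderivWithin ℝ θ (Q ∩ U) z) (Q ∩ U) z :=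
    fun z hz => (hθ.differentiableOn (by simp) z hz).hasFDerivWithinAt
  -- Lipschitz estimate
  have hlip : LipschitzOnWith c (fun z => θ z - z) (Q ∩ Metric.ball p r) := by
    refine Convex.lipschitzOnWith_of_nnnorm_hasFDerivWithin_le
      (f' := fun z => fderivWithin ℝ θ (Q ∩ U) z - ContinuousLinearMap.id ℝ E)
      (fun z hz => ?_) (fun z hz => ?_) ((convex_halfSpace ℓ).inter (convex_ball p r))
    · exact ((hD z ⟨hz.1, hrU hz.2⟩).mono (inter_subset_inter_right _ hrU)).sub
        (hasFDerivWithinAt_id z _)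
    · exact_mod_cast hrc z hz
  set Θ : E → E := fun x => θ (ρ x) + (x - ρ x) with hΘ
  have hΘθ : ∀ x ∈ Q, Θ x = θ x := fun x hx => by simp [hΘ, hρid x hx]
  have hρcont : Continuous ρ := hρ.continuous
  set V : Set E := ρ ⁻¹' Metric.ball p r ∩ Metric.ball p r with hV
  have hVo : IsOpen V := (Metric.isOpen_ball.preimage hρcont).inter Metric.isOpen_ball
  have hpV : p ∈ V := ⟨by simp [hρid p hp, hr], by simp [hr]⟩
  have happrox : ApproximatesLinearOn Θ
      ((ContinuousLinearEquiv.refl ℝ E : E ≃L[ℝ] E) : E →L[ℝ] E) V (1 / 2) := by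
    have h1 : LipschitzOnWith (c * C) ((fun z => θ z - z) ∘ ρ) V :=
      hlip.comp (hρ.lipschitzOnWith) fun x hx => ⟨hρQ x, hx.1⟩
    have h2 : (fun z => θ z - z) ∘ ρ =
        Θ - ⇑((ContinuousLinearEquiv.refl ℝ E : E ≃L[ℝ] E) : E →L[ℝ] E) := by
      funext x
      simp [hΘ]
      abel
    rw [h2] at h1
    exact ApproximatesLinearOn.approximatesLinearOn_iff_lipschitzOnWith.2 (h1.weaken hcC)
  have hhalf : Subsingleton E ∨ (1 / 2 : NNReal) <
      ‖((ContinuousLinearEquiv.refl ℝ E).symm : E →L[ℝ] E)‖₊⁻¹ := by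
    rcases subsingleton_or_nontrivial E with h | h
    · exact Or.inl h
    · refine Or.inr ?_
      have : ‖((ContinuousLinearEquiv.refl ℝ E).symm : E →L[ℝ] E)‖₊ = 1 := by
        ext; exact ContinuousLinearMap.norm_id
      rw [this, inv_one]
      exact one_half_lt_one
  set e₀ := happrox.toOpenPartialHomeomorph Θ V hhalf hVo with he₀
  -- shrink if `p` is an interior point
  obtain ⟨e, hes, hee, hpe, hQe⟩ : ∃ e : OpenPartialHomeomorph E E, e.source ⊆ V ∧
      (⇑e = Θ) ∧ p ∈ e.source ∧ (∀ z ∈ e.source, 0 ≤ ℓ (e z) ↔ 0 ≤ ℓ z) := by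
    by_cases h0 : ℓ p = 0
    · refine ⟨e₀, subset_rfl, rfl, hpV, fun z hz => ?_⟩
      have h1 : ℓ (Θ z) = ℓ z := by
        simp [hΘ, hℓ h0 (ρ z) ⟨hρQ z, hrU hz.1⟩]
      change 0 ≤ ℓ (Θ z) ↔ _
      rw [h1]
    · have hpos : 0 < ℓ p := lt_of_le_of_ne hp (Ne.symm h0)
      have hop : IsOpen (V ∩ Θ ⁻¹' {v | 0 < ℓ v}) :=
        (happrox.continuousOn).isOpen_inter_preimage hVo
          (isOpen_lt continuous_const ℓ.continuous)
      refine ⟨e₀.restrOpen ((V ∩ Θ ⁻¹' {v | 0 < ℓ v}) ∩ {v | 0 < ℓ v})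
        (hop.inter (isOpen_lt continuous_const ℓ.continuous)), ?_, rfl, ?_, ?_⟩
      · intro z hz; exact hz.1
      · refine ⟨hpV, ⟨hpV, ?_⟩, hpos⟩
        change 0 < ℓ (Θ p)
        rw [hΘθ p hp, hθp]; exact hpos
      · intro z hz
        exact iff_of_true (le_of_lt hz.2.1.2) (le_of_lt hz.2.2)
  have hex : EqOn e θ (Q ∩ e.source) := fun z hz => by rw [hee, hΘθ z hz.1]
  -- derivatives
  have hAex : ∀ z, ∃ A : E ≃L[ℝ] E, z ∈ Q ∩ e.source →
      HasFDerivWithinAt θ (A : E →L[ℝ] E) (Q ∩ e.source) z := by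
    intro z
    by_cases hz : z ∈ Q ∩ e.source
    · obtain ⟨A, hA⟩ := exists_continuousLinearEquiv_of_norm_sub_id_lt _
        (NNReal.coe_lt_one.2 hc1) (hrc z ⟨hz.1, (hes hz.2).2⟩)
      refine ⟨A, fun _ => ?_⟩
      rw [hA]
      exact (hD z ⟨hz.1, hrU (hes hz.2).2⟩).mono
        (inter_subset_inter_right _ fun y hy => hrU (hes hy).2)
    · exact ⟨ContinuousLinearEquiv.refl ℝ E, fun h => absurd h hz⟩
  choose A hA using hAex
  have hsymmQ : MapsTo e.symm (Q ∩ e.target) (Q ∩ e.source) := by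
    intro y hy
    refine ⟨(hQe _ (e.map_target hy.2)).1 ?_, e.map_target hy.2⟩
    rw [e.right_inv hy.2]; exact hy.1
  have hB : ∀ y ∈ Q ∩ e.target,
      HasFDerivWithinAt e.symm ((A (e.symm y)).symm : E →L[ℝ] E) (Q ∩ e.target) y := by
    intro y hy
    have hz := hsymmQ hy
    have h1 : HasFDerivWithinAt e (A (e.symm y) : E →L[ℝ] E) (Q ∩ e.source) (e.symm y) :=
      (hA _ hz).congr hex (hex hz)
    refine HasFDerivWithinAt.of_local_left_inverse ?_ h1 hy ?_
    · have hc : ContinuousWithinAt e.symm (Q ∩ e.target) y :=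
        (e.continuousAt_symm hy.2).continuousWithinAt
      exact hc.tendsto_nhdsWithin hsymmQ
    · filter_upwards [self_mem_nhdsWithin] with a ha using e.right_inv ha.2
  have hus := uniqueDiffOn_halfSpace_inter ℓ e.open_source
  have hut := uniqueDiffOn_halfSpace_inter ℓ e.open_target
  refine ⟨e, fun z hz => hrU (hes hz).2, hpe, hex, hQe, ?_, fun z hz => ⟨A z, ?_, ?_⟩⟩
  · exact contDiffOn_symm_of_invertible hus hut
      (hθ.mono (inter_subset_inter_right _ fun y hy => hrU (hes hy).2)) hsymmQ A hA hB
  · exact (hasFDerivWithinAt_inter (e.open_source.mem_nhds hz.2)).1 (hA z hz)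
  · have hy : e z ∈ Q ∩ e.target := ⟨(hQe z hz.2).2 hz.1, e.map_source hz.2⟩
    have := hB _ hy
    rw [e.left_inv hz.2] at this
    exact (hasFDerivWithinAt_inter (e.open_target.mem_nhds hy.2)).1 this

end HalfSpace

/-! ### Level sets of maps on half-spaces -/

theorem exists_isCompl_le_of_sup_eq_top {α : Type*} [Lattice α] [BoundedOrder α]
    [IsModularLattice α] [ComplementedLattice α] {a b : α} (h : a ⊔ b = ⊤) :
    ∃ c ≤ b, IsCompl a c := by
  obtain ⟨d, hd⟩ := exists_isCompl (a ⊓ b)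
  refine ⟨d ⊓ b, inf_le_right, disjoint_iff.2 ?_, codisjoint_iff.2 ?_⟩
  · rw [inf_comm d b, ← inf_assoc, hd.inf_eq_bot]
  · have h1 : a ⊓ b ⊔ d ⊓ b = b := by
      rw [← sup_inf_assoc_of_le d inf_le_right, hd.sup_eq_top, top_inf_eq]
    calc a ⊔ d ⊓ b = a ⊔ a ⊓ b ⊔ d ⊓ b := by rw [sup_inf_self]
      _ = a ⊔ b := by rw [sup_assoc, h1]
      _ = ⊤ := h

/-- A linear map has outer inverses with prescribed bounds on range and kernel. -/
theorem LinearMap.exists_outer_inverse {K E F : Type*} [Field K] [AddCommGroup E] [Module K E]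
    [AddCommGroup F] [Module K F] (D : E →ₗ[K] F) (V : Submodule K E) (N : Submodule K F)
    (h : V.map D ⊔ N = ⊤) :
    ∃ L : F →ₗ[K] E, (∀ f, L f ∈ V) ∧ (∀ f, L (D (L f)) = L f) ∧ (∀ f, L f = 0 → f ∈ N) ∧
      ∀ v ∈ V, L (D v) = 0 → D v = 0 := by
  obtain ⟨N', hN', hc⟩ := exists_isCompl_le_of_sup_eq_top h
  have hr : LinearMap.range (D.domRestrict V) = V.map D := by
    ext f
    simp only [LinearMap.mem_range, Submodule.mem_map, LinearMap.domRestrict_apply]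
    exact ⟨fun ⟨y, hy⟩ => ⟨y, y.2, hy⟩, fun ⟨y, hy, he⟩ => ⟨⟨y, hy⟩, he⟩⟩
  rw [← hr] at hc
  obtain ⟨s, hs⟩ := (D.domRestrict V).rangeRestrict.exists_rightInverse_of_surjective
    (LinearMap.range_rangeRestrict _)
  set P := Submodule.projectionOnto _ _ hc with hP
  have hDs : ∀ f, D (s (P f)) = P f := fun f => by
    have := congrArg Subtype.val (LinearMap.congr_fun hs (P f))
    simpa using this
  have hPmem : ∀ v ∈ V, (P (D v) : F) = D v := fun v hv => by
    have : P ((D.domRestrict V).rangeRestrict ⟨v, hv⟩ : F) =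
      (D.domRestrict V).rangeRestrict ⟨v, hv⟩ := Submodule.projectionOnto_apply_left hc _
    exact congrArg Subtype.val this
  refine ⟨V.subtype ∘ₗ s ∘ₗ P, fun f => (s (P f)).2, fun f => ?_, fun f hf => hN' ?_,
    fun v hv hv0 => ?_⟩
  · have h1 : P (D (s (P f))) = P f := by
      rw [hDs, Submodule.projectionOnto_apply_left hc]
    simp [h1]
  · have h1 : (s (P f) : E) = 0 := hf
    have h2 := hDs f
    rw [h1, map_zero] at h2
    exact (Submodule.projectionOnto_apply_eq_zero_iff hc).1 (Subtype.ext h2.symm)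
  · have h1 : (s (P (D v)) : E) = 0 := hv0
    have h2 := hDs (D v)
    rw [h1, map_zero, hPmem v hv] at h2
    exact h2.symm

section HalfSpace

variable {E : Type*} [NormedAddCommGroup E] [NormedSpace ℝ E]
  {F : Type*} [NormedAddCommGroup F] [NormedSpace ℝ F]

/-- Local diffeomorphisms of a half-space. -/
structure IsHalfSpaceDiffeo (ℓ : E →L[ℝ] ℝ) (e : OpenPartialHomeomorph E E) : Prop where
  mem_iff : ∀ z ∈ e.source, 0 ≤ ℓ (e z) ↔ 0 ≤ ℓ z
  contDiffOn : ContDiffOn ℝ ∞ e ({v | 0 ≤ ℓ v} ∩ e.source)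
  contDiffOn_symm : ContDiffOn ℝ ∞ e.symm ({v | 0 ≤ ℓ v} ∩ e.target)

theorem IsHalfSpaceDiffeo.restrOpen {ℓ : E →L[ℝ] ℝ} {e : OpenPartialHomeomorph E E}
    (he : IsHalfSpaceDiffeo ℓ e) {s : Set E} (hs : IsOpen s) :
    IsHalfSpaceDiffeo ℓ (e.restrOpen s hs) where
  mem_iff z hz := he.mem_iff z hz.1
  contDiffOn := he.contDiffOn.mono fun _ hz => ⟨hz.1, hz.2.1⟩
  contDiffOn_symm := he.contDiffOn_symm.mono fun _ hz => ⟨hz.1, hz.2.1⟩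

theorem IsHalfSpaceDiffeo.mapsTo_symm {ℓ : E →L[ℝ] ℝ} {e : OpenPartialHomeomorph E E}
    (he : IsHalfSpaceDiffeo ℓ e) :
    MapsTo e.symm ({v | 0 ≤ ℓ v} ∩ e.target) ({v | 0 ≤ ℓ v} ∩ e.source) := fun v hv =>
  ⟨(he.mem_iff _ (e.map_target hv.2)).1 (by rw [e.right_inv hv.2]; exact hv.1),
    e.map_target hv.2⟩

variable [FiniteDimensional ℝ E]

/-- Straightening a map `Φ` by means of an outer inverse `L` of its differential `D` at `p`. -/
theorem exists_outer_straightening (ℓ : E →L[ℝ] ℝ) {U : Set E} (hU : IsOpen U)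
    {p : E} (hp : 0 ≤ ℓ p) (hpU : p ∈ U) {Φ : E → F}
    (hΦ : ContDiffOn ℝ ∞ Φ ({v | 0 ≤ ℓ v} ∩ U)) {D : E →L[ℝ] F}
    (hD : fderivWithin ℝ Φ {v | 0 ≤ ℓ v} p = D)
    (L : F →L[ℝ] E) (hℓ : ℓ p = 0 → ∀ f, ℓ (L f) = 0) :
    ∃ e : OpenPartialHomeomorph E E, IsHalfSpaceDiffeo ℓ e ∧ e.source ⊆ U ∧ p ∈ e.source ∧
      (∀ z ∈ e.source, 0 ≤ ℓ z → e z = z + L (Φ z - Φ p - D (z - p))) ∧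
      ∀ z ∈ e.source, 0 ≤ ℓ z → ∃ A : E ≃L[ℝ] E,
        (∀ w, A w = w + L (fderivWithin ℝ Φ {v | 0 ≤ ℓ v} z w - D w)) ∧
        HasFDerivWithinAt e.symm (A.symm : E →L[ℝ] E) {v | 0 ≤ ℓ v} (e z) := by
  set Q : Set E := {v | 0 ≤ ℓ v} with hQ
  set θ : E → E := fun z => z + L (Φ z - Φ p - D (z - p)) with hθdef
  have hu : UniqueDiffOn ℝ Q := uniqueDiffOn_convex (convex_halfSpace ℓ)
    (interior_halfSpace_nonempty ℓ)
  have hθ : ContDiffOn ℝ ∞ θ (Q ∩ U) := by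
    refine contDiffOn_id.add (L.contDiff.comp_contDiffOn ((hΦ.sub contDiffOn_const).sub ?_))
    exact (D.contDiff.comp (contDiff_id.sub contDiff_const)).contDiffOn
  have hder : ∀ z ∈ Q ∩ U, HasFDerivWithinAt θ
      (ContinuousLinearMap.id ℝ E + L.comp (fderivWithin ℝ Φ Q z - D)) Q z := by
    intro z hz
    have h0 : HasFDerivWithinAt Φ (fderivWithin ℝ Φ Q z) Q z := by
      have := hΦ.differentiableOn (by simp) z hz
      exact ((differentiableWithinAt_inter (hU.mem_nhds hz.2)).1 this).hasFDerivWithinAt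
    refine (hasFDerivWithinAt_id z _).add (L.hasFDerivAt.comp_hasFDerivWithinAt z ?_)
    refine (h0.sub_const (Φ p)).sub ?_
    exact D.hasFDerivAt.comp_hasFDerivWithinAt z ((hasFDerivWithinAt_id z Q).sub_const p)
  obtain ⟨e, heU, hpe, heθ, hiff, hsymm, hA⟩ := exists_straightening ℓ hU hp hpU hθ
    (by simpa [hD] using hder p ⟨hp, hpU⟩) (by simp [hθdef])
    (fun h0 z _ => by simp [hθdef, hℓ h0])
  refine ⟨e, ⟨hiff, (hθ.mono (inter_subset_inter_right _ heU)).congr heθ, hsymm⟩, heU, hpe,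
    fun z hz hz0 => heθ ⟨hz0, hz⟩, fun z hz hz0 => ?_⟩
  obtain ⟨A, hA1, hA2⟩ := hA z ⟨hz0, hz⟩
  refine ⟨A, fun w => ?_, hA2⟩
  have := (hu z hz0).eq hA1 (hder z ⟨hz0, heU hz⟩)
  simpa using DFunLike.congr_fun this w

omit [FiniteDimensional ℝ E] in
theorem outer_straightening_apply {D : E →L[ℝ] F} {L : F →L[ℝ] E}
    (hL : ∀ f, L (D (L f)) = L f) (f : F) (v : E) : L (D (v + L (f - D v))) = L f := by
  simp [hL]

/-- If the rank of `Φ` is constant along the level set of the first component of `Φ`, then `Φ` is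
locally constant on the slices of a straightening. -/
theorem exists_ball_eq_of_mem_slice {F₁ F₂ : Type*} [NormedAddCommGroup F₁] [NormedSpace ℝ F₁]
    [NormedAddCommGroup F₂] [NormedSpace ℝ F₂]
    (ℓ : E →L[ℝ] ℝ) {U : Set E} (hU : IsOpen U)
    {p : E} (hp : 0 ≤ ℓ p) {Φ : E → F₁ × F₂}
    (hΦ : ContDiffOn ℝ ∞ Φ ({v | 0 ≤ ℓ v} ∩ U)) {D : E →L[ℝ] F₁ × F₂}
    {L : F₁ × F₂ →L[ℝ] E} (hL : ∀ f, L (D (L f)) = L f) (hL1 : ∀ f, L f = 0 → f.1 = 0)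
    (W : Submodule ℝ E) (hLW : ∀ f, L f ∈ W) (hker : ∀ v ∈ W, L (D v) = 0 → D v = 0)
    (hrank : ∀ z ∈ U, 0 ≤ ℓ z → z - p ∈ W → (Φ z).1 = (Φ p).1 →
      Module.finrank ℝ ↥(LinearMap.ker (fderivWithin ℝ Φ {v | 0 ≤ ℓ v} z : E →ₗ[ℝ] F₁ × F₂) ⊓ W) =
      Module.finrank ℝ ↥(LinearMap.ker (D : E →ₗ[ℝ] F₁ × F₂) ⊓ W))
    {e : OpenPartialHomeomorph E E} (he : IsHalfSpaceDiffeo ℓ e) (heU : e.source ⊆ U)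
    (hpe : p ∈ e.source)
    (heΦ : ∀ z ∈ e.source, 0 ≤ ℓ z → e z = z + L (Φ z - Φ p - D (z - p)))
    (heA : ∀ z ∈ e.source, 0 ≤ ℓ z → ∃ A : E ≃L[ℝ] E,
        (∀ w, A w = w + L (fderivWithin ℝ Φ {v | 0 ≤ ℓ v} z w - D w)) ∧
        HasFDerivWithinAt e.symm (A.symm : E →L[ℝ] E) {v | 0 ≤ ℓ v} (e z)) :
    ∃ r > 0, Metric.ball p r ⊆ e.target ∧ ∀ v ∈ Metric.ball p r, 0 ≤ ℓ v → v - p ∈ W →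
      L (D (v - p)) = 0 → Φ (e.symm v) = Φ p := by
  have hep : e p = p := by rw [heΦ p hpe hp]; simp
  have hpt : p ∈ e.target := by rw [← hep]; exact e.map_source hpe
  obtain ⟨r, hr, hrt⟩ := Metric.isOpen_iff.1 e.open_target p hpt
  refine ⟨r, hr, hrt, ?_⟩
  set Q : Set E := {v | 0 ≤ ℓ v} with hQ
  let S : Submodule ℝ E := LinearMap.ker ((L.comp D : E →L[ℝ] E) : E →ₗ[ℝ] E) ⊓ W
  let s : Set S := (fun w : S => p + (w : E)) ⁻¹' (Q ∩ Metric.ball p r)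
  have hs : Convex ℝ s := by
    have h1 : Convex ℝ (Q ∩ Metric.ball p r) := (convex_halfSpace ℓ).inter (convex_ball p r)
    exact (h1.translate_preimage_right p).linear_preimage S.subtype
  have hst : ∀ w ∈ s, e.symm (p + w) ∈ e.source ∧ 0 ≤ ℓ (e.symm (p + w)) := fun w hw => by
    have := he.mapsTo_symm ⟨hw.1, hrt hw.2⟩
    exact ⟨this.2, this.1⟩
  have hder : ∀ w ∈ s, HasFDerivWithinAt (fun w : S => Φ (e.symm (p + (w : E))))
      (0 : S →L[ℝ] F₁ × F₂) s w := by
    intro w hw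
    obtain ⟨hzs, hz0⟩ := hst w hw
    set z := e.symm (p + (w : E)) with hz
    have hez : e z = p + w := e.right_inv (hrt hw.2)
    obtain ⟨A, hA, hAe⟩ := heA z hzs hz0
    rw [hez] at hAe
    have hw1 : L (D (w : E)) = 0 := w.2.1
    have hzw : z - p + L (Φ z - Φ p - D (z - p)) = w := by
      have := heΦ z hzs hz0
      rw [hez] at this
      rw [← sub_eq_iff_eq_add'.2 this]; abel
    have hz1 : (Φ z).1 = (Φ p).1 := by
      have h2 := outer_straightening_apply hL (Φ z - Φ p) (z - p)
      rw [hzw, hw1] at h2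
      exact sub_eq_zero.1 (hL1 _ h2.symm)
    have hzW : z - p ∈ W := by
      have : z - p = w - L (Φ z - Φ p - D (z - p)) := by rw [← hzw]; abel
      rw [this]
      exact W.sub_mem w.2.2 (hLW _)
    set Dz := fderivWithin ℝ Φ Q z with hDz
    have hAW : ∀ u, A u ∈ W ↔ u ∈ W := fun u => by
      rw [hA]; exact W.add_mem_iff_left (hLW _)
    have hLA : ∀ u, L (D (A u)) = L (Dz u) := fun u => by
      rw [hA]; exact outer_straightening_apply hL _ _
    -- kernels
    let K₁ : Submodule ℝ E := LinearMap.ker (Dz : E →ₗ[ℝ] F₁ × F₂) ⊓ W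
    let K₂ : Submodule ℝ E := LinearMap.ker ((L.comp Dz : E →L[ℝ] E) : E →ₗ[ℝ] E) ⊓ W
    have hK : K₁ = K₂ := by
      refine Submodule.eq_of_le_of_finrank_le (fun u hu => ⟨?_, hu.2⟩) ?_
      · have : Dz u = 0 := hu.1
        change L (Dz u) = 0
        rw [this, map_zero]
      · rw [hrank z (heU hzs) hz0 hzW hz1]
        have hmap : K₂.map (A : E →ₗ[ℝ] E) ≤ LinearMap.ker (D : E →ₗ[ℝ] F₁ × F₂) ⊓ W := by
          rintro _ ⟨u, hu, rfl⟩
          have h1 : A u ∈ W := (hAW u).2 hu.2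
          exact ⟨hker _ h1 ((hLA u).trans hu.1), h1⟩
        have h2 := Submodule.finrank_mono hmap
        exact (LinearEquiv.finrank_map_eq A.toLinearEquiv K₂).symm.le.trans h2
    have hΦz : HasFDerivWithinAt Φ Dz Q z := by
      have := hΦ.differentiableOn (by simp) z ⟨hz0, heU hzs⟩
      exact ((differentiableWithinAt_inter (hU.mem_nhds (heU hzs))).1 this).hasFDerivWithinAt
    have hin : HasFDerivWithinAt (fun w : S => p + (w : E)) S.subtypeL s w :=
      (S.subtypeL.hasFDerivAt.const_add p).hasFDerivWithinAt
    have hmid : HasFDerivWithinAt (fun w : S => e.symm (p + (w : E)))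
        ((A.symm : E →L[ℝ] E).comp S.subtypeL) s w :=
      hAe.comp w hin fun u hu => hu.1
    refine (hΦz.comp w hmid fun u hu => (hst u hu).2).congr_fderiv ?_
    ext1 u
    have h3 : A.symm (u : E) ∈ K₂ := by
      refine ⟨?_, ?_⟩
      · change L (Dz (A.symm (u : E))) = 0
        rw [← hLA, A.apply_symm_apply]; exact u.2.1
      · change A.symm (u : E) ∈ W
        rw [← hAW, A.apply_symm_apply]; exact u.2.2
    rw [← hK] at h3
    exact h3.1
  intro v hv hv0 hvW hvL
  have h0s : (0 : S) ∈ s := by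
    constructor
    · change 0 ≤ ℓ (p + 0)
      simpa using hp
    · simpa using hr
  have hvs : (⟨v - p, hvL, hvW⟩ : S) ∈ s := by
    constructor
    · change 0 ≤ ℓ (p + (v - p))
      simpa using hv0
    · change p + (v - p) ∈ Metric.ball p r
      simpa using hv
  have key := hs.norm_image_sub_le_of_norm_hasFDerivWithin_le (C := 0) hder (by simp) h0s hvs
  have key' : Φ (e.symm (p + (v - p))) - Φ (e.symm (p + ((0 : S) : E))) = 0 := by
    simpa using key
  rw [ZeroMemClass.coe_zero, add_zero, add_sub_cancel, ← hep, e.left_inv hpe] at key'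
  exact sub_eq_zero.1 key'

end HalfSpace

section HalfSpace

variable {E : Type*} [NormedAddCommGroup E] [NormedSpace ℝ E] [FiniteDimensional ℝ E]
  {F : Type*} [NormedAddCommGroup F] [NormedSpace ℝ F]

omit [FiniteDimensional ℝ E] in
/-- If `G` vanishes at two points of a half-space whose difference is a small multiple of a direction
in which the derivative of `G` does not vanish, then the points agree. -/
theorem exists_ball_eq_zero_of_eq (ℓ : E →L[ℝ] ℝ) {U : Set E} (hU : IsOpen U)
    {p : E} (hp : 0 ≤ ℓ p) (hpU : p ∈ U) {G : E → F}
    (hG : ContDiffOn ℝ ∞ G ({v | 0 ≤ ℓ v} ∩ U)) {D : E →L[ℝ] F}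
    (hD : HasFDerivWithinAt G D {v | 0 ≤ ℓ v} p) {e : E} (he : D e ≠ 0) :
    ∃ r > 0, ∀ v ∈ Metric.ball p r, ∀ b : ℝ, 0 ≤ ℓ v → 0 ≤ ℓ (v - b • e) →
      v - b • e ∈ Metric.ball p r → G v = G (v - b • e) → b = 0 := by
  have hu := uniqueDiffOn_halfSpace_inter ℓ hU
  have hp' : p ∈ {v | 0 ≤ ℓ v} ∩ U := ⟨hp, hpU⟩
  have hcont := hG.continuousOn_fderivWithin hu (by simp) p hp'
  have hdp : fderivWithin ℝ G ({v | 0 ≤ ℓ v} ∩ U) p = D :=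
    (hD.mono inter_subset_left).fderivWithin (hu p hp')
  have he0 : 0 < ‖e‖ := norm_pos_iff.2 fun h => he (by rw [h, map_zero])
  set c : ℝ := ‖D e‖ / (2 * ‖e‖) with hc
  have hc0 : 0 < c := div_pos (norm_pos_iff.2 he) (by positivity)
  have hev := Metric.tendsto_nhds.1 hcont c hc0
  rw [eventually_nhdsWithin_iff] at hev
  obtain ⟨r, hr, hball⟩ := Metric.eventually_nhds_iff_ball.1 (hev.and (hU.mem_nhds hpU))
  refine ⟨r, hr, fun v hv b hv0 hvb hvr hGv => ?_⟩
  have hsub : {v | 0 ≤ ℓ v} ∩ Metric.ball p r ⊆ {v | 0 ≤ ℓ v} ∩ U :=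
    inter_subset_inter_right _ fun z hz => (hball z hz).2
  have key := Convex.norm_image_sub_le_of_norm_hasFDerivWithin_le' (f := G) (φ := D) (C := c)
    (f' := fderivWithin ℝ G ({v | 0 ≤ ℓ v} ∩ U)) (s := {v | 0 ≤ ℓ v} ∩ Metric.ball p r)
    (fun z hz => (hG.differentiableOn (by simp) z (hsub hz)).hasFDerivWithinAt.mono hsub)
    (fun z hz => by
      have := (hball z hz.2).1 (hsub hz)
      rw [hdp, dist_eq_norm] at this
      exact this.le)
    ((convex_halfSpace ℓ).inter (convex_ball p r)) (x := v - b • e) (y := v) ⟨hvb, hvr⟩ ⟨hv0, hv⟩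
  rw [hGv, sub_self, zero_sub, norm_neg, sub_sub_cancel, map_smul, norm_smul, norm_smul] at key
  have h1 : c * (‖b‖ * ‖e‖) = ‖b‖ * ‖D e‖ / 2 := by
    rw [hc]; field_simp
  rw [h1] at key
  by_contra hb
  have : 0 < ‖b‖ * ‖D e‖ := mul_pos (norm_pos_iff.2 hb) (norm_pos_iff.2 he)
  linarith

/-- Regularity of a level set of `Φ = (σ, τ)` in a half-space, in a neighbourhood of a point `p`. -/
theorem exists_slice_diffeo {F₁ F₂ : Type*} [NormedAddCommGroup F₁] [NormedSpace ℝ F₁]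
    [NormedAddCommGroup F₂] [NormedSpace ℝ F₂] [FiniteDimensional ℝ F₁] [FiniteDimensional ℝ F₂]
    (ℓ : E →L[ℝ] ℝ) {U : Set E} (hU : IsOpen U)
    {p : E} (hp : 0 ≤ ℓ p) (hpU : p ∈ U) {Φ : E → F₁ × F₂}
    (hΦ : ContDiffOn ℝ ∞ Φ ({v | 0 ≤ ℓ v} ∩ U)) (k : ℕ) (P : Prop)
    (hrank : ∀ z ∈ U, 0 ≤ ℓ z → (Φ z).1 = (Φ p).1 →
      Module.finrank ℝ ↥(LinearMap.ker
        (fderivWithin ℝ Φ {v | 0 ≤ ℓ v} z : E →ₗ[ℝ] F₁ × F₂)) = k)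
    (hbd : ℓ ≠ 0 → ∀ z ∈ U, ℓ z = 0 → (Φ z).1 = (Φ p).1 →
      (LinearMap.ker (fderivWithin ℝ Φ {v | 0 ≤ ℓ v} z : E →ₗ[ℝ] F₁ × F₂) ≤
        LinearMap.ker (ℓ : E →ₗ[ℝ] ℝ) ↔ P))
    (hsurj : ∀ w, ∃ v, (ℓ p = 0 → ℓ v = 0) ∧ (fderivWithin ℝ Φ {v | 0 ≤ ℓ v} p v).1 = w) :
    ∃ (e : OpenPartialHomeomorph E E) (K : Submodule ℝ E), IsHalfSpaceDiffeo ℓ e ∧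
      e.source ⊆ U ∧ p ∈ e.source ∧ e p = p ∧ Module.finrank ℝ K = k ∧
      ∀ z ∈ e.source, 0 ≤ ℓ z → (Φ z = Φ p ↔ e z - p ∈ K) := by
  set D := fderivWithin ℝ Φ {v | 0 ≤ ℓ v} p with hD
  set K : Submodule ℝ E := LinearMap.ker (D : E →ₗ[ℝ] F₁ × F₂) with hK
  let V : Submodule ℝ E := if ℓ p = 0 then LinearMap.ker (ℓ : E →ₗ[ℝ] ℝ) else ⊤
  have hV : ∀ v, v ∈ V ↔ (ℓ p = 0 → ℓ v = 0) := fun v => by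
    by_cases h0 : ℓ p = 0 <;> simp [V, h0]
  obtain ⟨L₀, hL0V, hL0, hL01, hL0ker⟩ := LinearMap.exists_outer_inverse
    (D : E →ₗ[ℝ] F₁ × F₂) V (LinearMap.ker (LinearMap.fst ℝ F₁ F₂)) (by
      refine eq_top_iff.2 fun f _ => ?_
      obtain ⟨v, hv, hvf⟩ := hsurj f.1
      refine Submodule.mem_sup.2 ⟨D v, ⟨v, (hV v).2 hv, rfl⟩, f - D v, ?_, by abel⟩
      simp [hvf])
  set L : F₁ × F₂ →L[ℝ] E := LinearMap.toContinuousLinearMap L₀ with hLdef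
  have hLV : ∀ f, L f ∈ V := hL0V
  have hL : ∀ f, L (D (L f)) = L f := hL0
  have hL1 : ∀ f, L f = 0 → f.1 = 0 := hL01
  have hLker : ∀ v ∈ V, L (D v) = 0 → D v = 0 := hL0ker
  have hℓL : ℓ p = 0 → ∀ f, ℓ (L f) = 0 := fun h0 f => (hV _).1 (hLV f) h0
  have hkp : Module.finrank ℝ K = k := hrank p hpU hp rfl
  obtain ⟨e, he, heU, hpe, heΦ, heA⟩ :=
    exists_outer_straightening ℓ hU hp hpU hΦ hD.symm L hℓL
  have hep : e p = p := by rw [heΦ p hpe hp]; simp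
  have hpt : p ∈ e.target := by rw [← hep]; exact e.map_source hpe
  have hLe : ∀ z ∈ e.source, 0 ≤ ℓ z → L (D (e z - p)) = L (Φ z - Φ p) := fun z hz hz0 => by
    rw [heΦ z hz hz0, add_sub_right_comm]
    exact outer_straightening_apply hL _ _
  have hrestr : ∀ {r : ℝ}, 0 < r → (∀ z ∈ e.source, e z ∈ Metric.ball p r → 0 ≤ ℓ z →
      (Φ z = Φ p ↔ e z - p ∈ K)) →
      ∃ (e : OpenPartialHomeomorph E E) (K : Submodule ℝ E), IsHalfSpaceDiffeo ℓ e ∧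
      e.source ⊆ U ∧ p ∈ e.source ∧ e p = p ∧ Module.finrank ℝ K = k ∧
      ∀ z ∈ e.source, 0 ≤ ℓ z → (Φ z = Φ p ↔ e z - p ∈ K) := fun {r} hr h =>
    ⟨e.restrOpen _ (e.isOpen_inter_preimage Metric.isOpen_ball), K, he.restrOpen _,
      fun z hz => heU hz.1, ⟨hpe, hpe, by simpa [hep] using hr⟩, hep, hkp,
      fun z hz hz0 => h z hz.1 hz.2.2 hz0⟩
  by_cases hcase : ℓ p = 0 ∧ K ≤ LinearMap.ker (ℓ : E →ₗ[ℝ] ℝ) ∧ ℓ ≠ 0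
  · -- the level set is contained in the boundary
    obtain ⟨h0, hKℓ, hℓ⟩ := hcase
    have hP : P := (hbd hℓ p hpU h0 rfl).1 hKℓ
    have hVker : ∀ v, v ∈ V ↔ ℓ v = 0 := fun v => by simp [hV, h0]
    obtain ⟨r, hr, hrt, hball⟩ := exists_ball_eq_of_mem_slice ℓ hU hp hΦ hL hL1 V hLV hLker
      (fun z hz hz0 hzV hz1 => by
        have h0z : ℓ z = 0 := by
          have := (hVker _).1 hzV
          rwa [map_sub, h0, sub_zero] at this
        have h1 : LinearMap.ker (fderivWithin ℝ Φ {v | 0 ≤ ℓ v} z : E →ₗ[ℝ] F₁ × F₂) ≤ V :=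
          fun v hv => (hVker v).2 ((hbd hℓ z hz h0z hz1).2 hP hv)
        rw [inf_eq_left.2 h1, inf_eq_left.2 (show K ≤ V from fun v hv => (hVker v).2 (hKℓ hv)),
          hkp, hrank z hz hz0 hz1]) he heU hpe heΦ heA
    obtain ⟨e₀, he₀⟩ := exists_inward ℓ
    replace he₀ : ℓ e₀ = 1 := he₀.resolve_left hℓ
    set e' := e₀ - L (D e₀) with he'
    have hℓe' : ℓ e' = 1 := by rw [he', map_sub, hℓL h0, he₀, sub_zero]
    have hLe' : L (D e') = 0 := by rw [he', map_sub, map_sub, hL, sub_self]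
    have hDe' : D e' ≠ 0 := fun h => by
      have : ℓ e' = 0 := hKℓ h
      rw [hℓe'] at this
      exact one_ne_zero this
    have hG : ContDiffOn ℝ ∞ (Φ ∘ e.symm) ({v | 0 ≤ ℓ v} ∩ e.target) :=
      hΦ.comp he.contDiffOn_symm fun v hv => by
        have := he.mapsTo_symm hv
        exact ⟨this.1, heU this.2⟩
    have hGD : HasFDerivWithinAt (Φ ∘ e.symm) D {v | 0 ≤ ℓ v} p := by
      obtain ⟨A, hA, hAe⟩ := heA p hpe hp
      have hA1 : A = ContinuousLinearEquiv.refl ℝ E := by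
        ext w
        rw [hA, ← hD]; simp
      rw [hA1, hep] at hAe
      have h1 : HasFDerivWithinAt Φ D {v | 0 ≤ ℓ v} (e.symm p) := by
        rw [← hep, e.left_inv hpe]
        have := hΦ.differentiableOn (by simp) p ⟨hp, hpU⟩
        exact ((differentiableWithinAt_inter (hU.mem_nhds hpU)).1 this).hasFDerivWithinAt
      have h2 := h1.comp_of_tendsto p hAe (tendsto_nhdsWithin_of_tendsto_nhds_of_eventually_within _
        hAe.continuousWithinAt (by
          filter_upwards [inter_mem_nhdsWithin _ (e.open_target.mem_nhds hpt)] with v hv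
          exact (he.mapsTo_symm hv).1))
      simpa using h2
    obtain ⟨r', hr', hball'⟩ := exists_ball_eq_zero_of_eq ℓ e.open_target hp hpt hG hGD hDe'
    -- a ball whose projection to the boundary is contained in the two balls
    have hcont : Continuous fun v : E => v - ℓ v • e' :=
      continuous_id.sub (ℓ.continuous.smul continuous_const)
    obtain ⟨r'', hr'', hsub⟩ := Metric.isOpen_iff.1
      ((Metric.isOpen_ball (x := p) (ε := min r r')).preimage hcont) p
      (by simp [h0, hr, hr'])
    have hm : Metric.ball p (min r r') ⊆ Metric.ball p r :=
      Metric.ball_subset_ball (min_le_left _ _)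
    have hm' : Metric.ball p (min r r') ⊆ Metric.ball p r' :=
      Metric.ball_subset_ball (min_le_right _ _)
    refine hrestr (r := min r'' (min r r')) (lt_min hr'' (lt_min hr hr')) fun z hz hzb hz0 => ?_
    have hb1 : e z ∈ Metric.ball p (min r r') := Metric.ball_subset_ball (min_le_right _ _) hzb
    have hb2 : e z - ℓ (e z) • e' ∈ Metric.ball p (min r r') :=
      hsub (Metric.ball_subset_ball (min_le_left _ _) hzb)
    have hez0 : 0 ≤ ℓ (e z) := (he.mem_iff z hz).2 hz0
    constructor
    · intro h
      have h1 : L (D (e z - p)) = 0 := by rw [hLe z hz hz0, h, sub_self, map_zero]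
      have hproj : ℓ (e z - ℓ (e z) • e') = 0 := by simp [hℓe']
      have h2 : Φ (e.symm (e z - ℓ (e z) • e')) = Φ p := by
        refine hball _ (hm hb2) hproj.ge ((hVker _).2 ?_) ?_
        · rw [map_sub, hproj, h0, sub_zero]
        · rw [sub_right_comm, map_sub, map_sub, h1, map_smul, map_smul, hLe', smul_zero, sub_zero]
      have h3 : ℓ (e z) = 0 := by
        refine hball' (e z) (hm' hb1) (ℓ (e z)) hez0 hproj.ge (hm' hb2) ?_
        simp only [Function.comp_apply]
        rw [h2, e.left_inv hz, h]
      exact hLker _ ((hVker _).2 (by rw [map_sub, h3, h0, sub_zero])) h1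
    · intro h
      have h1 : D (e z - p) = 0 := h
      have h2 := hball (e z) (hm hb1) hez0 ((hVker _).2 (hKℓ h)) (by rw [h1, map_zero])
      rwa [e.left_inv hz] at h2
  · -- the level set is transversal to the boundary
    have hker : ∀ v, L (D v) = 0 → D v = 0 := by
      intro v hv
      by_cases h0 : ℓ p = 0 ∧ ℓ ≠ 0
      · have hn : ¬ K ≤ LinearMap.ker (ℓ : E →ₗ[ℝ] ℝ) := fun h => hcase ⟨h0.1, h, h0.2⟩
        obtain ⟨κ, hκ, hκℓ⟩ := SetLike.not_le_iff_exists.1 hn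
        have hκ0 : D κ = 0 := hκ
        have hκ1 : ℓ κ ≠ 0 := hκℓ
        have h1 : D (v - (ℓ v / ℓ κ) • κ) = D v := by simp [hκ0]
        rw [← h1]
        refine hLker _ ((hV _).2 fun _ => ?_) (by rw [h1, hv])
        simp [hκ1]
      · refine hLker v ((hV v).2 fun h => ?_) hv
        have : ℓ = 0 := by
          by_contra hne
          exact h0 ⟨h, hne⟩
        simp [this]
    obtain ⟨r, hr, hrt, hball⟩ := exists_ball_eq_of_mem_slice ℓ hU hp hΦ hL hL1 ⊤
      (fun _ => trivial) (fun v _ => hker v) (fun z hz hz0 _ hz1 => by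
        rw [inf_top_eq, inf_top_eq, hrank z hz hz0 hz1]; exact hkp.symm) he heU hpe heΦ heA
    refine hrestr hr fun z hz hzb hz0 => ⟨fun h => ?_, fun h => ?_⟩
    · exact hker _ (by rw [hLe z hz hz0, h, sub_self, map_zero])
    · have h1 : D (e z - p) = 0 := h
      have h2 := hball (e z) hzb ((he.mem_iff z hz).2 hz0) trivial (by rw [h1, map_zero])
      rwa [e.left_inv hz] at h2

end HalfSpace

/-! ### Charts adapted to a subset -/

section Charts

variable {E : Type*} [NormedAddCommGroup E] [NormedSpace ℝ E]
  {H : Type*} [TopologicalSpace H]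
  {M : Type*} [TopologicalSpace M] [ChartedSpace H M]

theorem StructureGroupoid.trans_mem_maximalAtlas {G : StructureGroupoid H}
    {φ : OpenPartialHomeomorph M H} (hφ : φ ∈ G.maximalAtlas M) {e : OpenPartialHomeomorph H H}
    (he : e ∈ G) : φ ≫ₕ e ∈ G.maximalAtlas M := by
  refine mem_maximalAtlas_iff.2 fun e' he' => ⟨?_, ?_⟩
  · rw [OpenPartialHomeomorph.trans_symm_eq_symm_trans_symm, OpenPartialHomeomorph.trans_assoc]
    exact G.trans (G.symm he) ((mem_maximalAtlas_iff.1 hφ e' he').1)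
  · rw [← OpenPartialHomeomorph.trans_assoc]
    exact G.trans ((mem_maximalAtlas_iff.1 hφ e' he').2) he

/-- A local diffeomorphism of a half-space, read in the model space. -/
noncomputable def IsHalfSpaceDiffeo.toModel {ℓ : E →L[ℝ] ℝ} {e : OpenPartialHomeomorph E E}
    (he : IsHalfSpaceDiffeo ℓ e) (I : ModelWithCorners ℝ E H) (hI : range I = {v | 0 ≤ ℓ v}) :
    OpenPartialHomeomorph H H where
  toFun x := I.symm (e (I x))
  invFun x := I.symm (e.symm (I x))
  source := I ⁻¹' e.source
  target := I ⁻¹' e.target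
  map_source' x hx := by
    have h1 : e (I x) ∈ range I := by
      rw [hI]; exact (he.mem_iff _ hx).2 (hI.subset (mem_range_self x))
    rw [mem_preimage, I.right_inv h1]
    exact e.map_source hx
  map_target' x hx := by
    have h1 : e.symm (I x) ∈ range I := by
      rw [hI]; exact (he.mapsTo_symm ⟨hI.subset (mem_range_self x), hx⟩).1
    rw [mem_preimage, I.right_inv h1]
    exact e.map_target hx
  left_inv' x hx := by
    have h1 : e (I x) ∈ range I := by
      rw [hI]; exact (he.mem_iff _ hx).2 (hI.subset (mem_range_self x))
    rw [I.right_inv h1, e.left_inv hx, I.left_inv]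
  right_inv' x hx := by
    have h1 : e.symm (I x) ∈ range I := by
      rw [hI]; exact (he.mapsTo_symm ⟨hI.subset (mem_range_self x), hx⟩).1
    rw [I.right_inv h1, e.right_inv hx, I.left_inv]
  open_source := e.open_source.preimage I.continuous
  open_target := e.open_target.preimage I.continuous
  continuousOn_toFun := I.continuous_symm.comp_continuousOn
    (e.continuousOn.comp I.continuous.continuousOn fun _ h => h)
  continuousOn_invFun := I.continuous_symm.comp_continuousOn
    (e.continuousOn_symm.comp I.continuous.continuousOn fun _ h => h)

theorem IsHalfSpaceDiffeo.toModel_mem {ℓ : E →L[ℝ] ℝ} {e : OpenPartialHomeomorph E E}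
    (he : IsHalfSpaceDiffeo ℓ e) (I : ModelWithCorners ℝ E H) (hI : range I = {v | 0 ≤ ℓ v}) :
    he.toModel I hI ∈ contDiffGroupoid ∞ I := by
  rw [contDiffGroupoid, mem_groupoid_of_pregroupoid]
  constructor
  · change ContDiffOn ℝ ∞ (I ∘ (fun x => I.symm (e (I x))) ∘ I.symm)
      (I.symm ⁻¹' (I ⁻¹' e.source) ∩ range I)
    refine (he.contDiffOn.mono ?_).congr ?_
    · rintro z ⟨hz1, hz2⟩
      rw [mem_preimage, mem_preimage, I.right_inv hz2] at hz1
      exact ⟨hI.subset hz2, hz1⟩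
    · rintro z ⟨hz1, hz2⟩
      rw [mem_preimage, mem_preimage, I.right_inv hz2] at hz1
      simp only [Function.comp_apply, I.right_inv hz2]
      exact I.right_inv (by rw [hI]; exact (he.mem_iff _ hz1).2 (hI.subset hz2))
  · change ContDiffOn ℝ ∞ (I ∘ (fun x => I.symm (e.symm (I x))) ∘ I.symm)
      (I.symm ⁻¹' (I ⁻¹' e.target) ∩ range I)
    refine (he.contDiffOn_symm.mono ?_).congr ?_
    · rintro z ⟨hz1, hz2⟩
      rw [mem_preimage, mem_preimage, I.right_inv hz2] at hz1
      exact ⟨hI.subset hz2, hz1⟩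
    · rintro z ⟨hz1, hz2⟩
      rw [mem_preimage, mem_preimage, I.right_inv hz2] at hz1
      simp only [Function.comp_apply, I.right_inv hz2]
      exact I.right_inv (by rw [hI]; exact (he.mapsTo_symm ⟨hI.subset hz2, hz1⟩).1)

/-- A chart composed with a local diffeomorphism of the half-space is a chart. -/
theorem IsHalfSpaceDiffeo.exists_chart {ℓ : E →L[ℝ] ℝ} {e : OpenPartialHomeomorph E E}
    (he : IsHalfSpaceDiffeo ℓ e) (I : ModelWithCorners ℝ E H) (hI : range I = {v | 0 ≤ ℓ v})
    {φ : OpenPartialHomeomorph M H} (hφ : φ ∈ IsManifold.maximalAtlas I ∞ M) :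
    ∃ ψ ∈ IsManifold.maximalAtlas I ∞ M,
      ψ.source = φ.source ∩ φ.extend I ⁻¹' e.source ∧
      ∀ q ∈ ψ.source, ψ.extend I q = e (φ.extend I q) := by
  refine ⟨φ ≫ₕ he.toModel I hI,
    StructureGroupoid.trans_mem_maximalAtlas hφ (he.toModel_mem I hI), ?_, fun q hq => ?_⟩
  · rw [OpenPartialHomeomorph.trans_source]; rfl
  · rw [OpenPartialHomeomorph.trans_source] at hq
    refine I.right_inv ?_
    rw [hI]
    exact (he.mem_iff _ hq.2).2 (hI.subset (mem_range_self (φ q)))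

end Charts

/-- A chart of `M` in which `S` is a piece of the affine image of the model `J`. -/
structure AffineSliceChart {E : Type*} [NormedAddCommGroup E] [NormedSpace ℝ E]
    {H : Type*} [TopologicalSpace H] (I : ModelWithCorners ℝ E H)
    {M : Type*} [TopologicalSpace M] [ChartedSpace H M] (S : Set M)
    {V : Type*} [NormedAddCommGroup V] [NormedSpace ℝ V]
    {HV : Type*} [TopologicalSpace HV] (J : ModelWithCorners ℝ V HV) where
  /-- the chart of the ambient manifold -/
  chart : OpenPartialHomeomorph M H
  chart_mem : chart ∈ IsManifold.maximalAtlas I ∞ M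
  /-- the base point of the affine embedding -/
  base : E
  /-- the linear part of the affine embedding -/
  lin : V →L[ℝ] E
  /-- a left inverse of the linear part -/
  retr : E →L[ℝ] V
  retr_lin : ∀ v, retr (lin v) = v
  /-- the domain of the affine embedding -/
  dom : Set V
  isOpen_dom : IsOpen dom
  map_dom : ∀ v ∈ dom, v ∈ range J → base + lin v ∈ (chart.extend I).target
  mem_iff : ∀ q ∈ chart.source, q ∈ S ↔ ∃ v ∈ dom, v ∈ range J ∧ base + lin v = chart.extend I q

namespace AffineSliceChart

variable {E : Type*} [NormedAddCommGroup E] [NormedSpace ℝ E]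
    {H : Type*} [TopologicalSpace H] {I : ModelWithCorners ℝ E H}
    {M : Type*} [TopologicalSpace M] [ChartedSpace H M] {S : Set M}
    {V : Type*} [NormedAddCommGroup V] [NormedSpace ℝ V]
    {HV : Type*} [TopologicalSpace HV] {J : ModelWithCorners ℝ V HV}

/-- The coordinates of a point. -/
noncomputable def coord (c : AffineSliceChart I S J) (q : M) : V := c.retr (c.chart.extend I q - c.base)

theorem coord_spec (c : AffineSliceChart I S J) {q : M} (hq : q ∈ c.chart.source) (hS : q ∈ S) :
    c.coord q ∈ c.dom ∧ c.coord q ∈ range J ∧ c.base + c.lin (c.coord q) = c.chart.extend I q := by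
  obtain ⟨v, hv, hvJ, hvq⟩ := (c.mem_iff q hq).1 hS
  have : c.coord q = v := by rw [coord, ← hvq, add_sub_cancel_left, c.retr_lin]
  rw [this]
  exact ⟨hv, hvJ, hvq⟩

/-- The point with given coordinates. -/
noncomputable def point (c : AffineSliceChart I S J) (v : V) : M :=
  (c.chart.extend I).symm (c.base + c.lin v)

theorem point_spec (c : AffineSliceChart I S J) {v : V} (hv : v ∈ c.dom) (hvJ : v ∈ range J) :
    c.point v ∈ c.chart.source ∧ c.point v ∈ S ∧
      c.chart.extend I (c.point v) = c.base + c.lin v ∧ c.coord (c.point v) = v := by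
  have h1 : c.point v ∈ c.chart.source := by
    have := (c.chart.extend I).map_target (c.map_dom v hv hvJ)
    rwa [OpenPartialHomeomorph.extend_source] at this
  have h2 : c.chart.extend I (c.point v) = c.base + c.lin v :=
    (c.chart.extend I).right_inv (c.map_dom v hv hvJ)
  refine ⟨h1, (c.mem_iff _ h1).2 ⟨v, hv, hvJ, h2.symm⟩, h2, ?_⟩
  rw [coord, h2, add_sub_cancel_left, c.retr_lin]

theorem point_coord (c : AffineSliceChart I S J) {q : M} (hq : q ∈ c.chart.source) (hS : q ∈ S) :
    c.point (c.coord q) = q := by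
  rw [point, (c.coord_spec hq hS).2.2]
  exact (c.chart.extend I).left_inv (by rwa [OpenPartialHomeomorph.extend_source])

theorem continuousOn_coord (c : AffineSliceChart I S J) :
    ContinuousOn c.coord c.chart.source := by
  have := c.chart.continuousOn_extend (I := I)
  rw [OpenPartialHomeomorph.extend_source] at this
  exact c.retr.continuous.comp_continuousOn (this.sub continuousOn_const)

theorem continuousOn_point (c : AffineSliceChart I S J) :
    ContinuousOn c.point (c.dom ∩ range J) :=
  c.chart.continuousOn_extend_symm.comp (continuous_const.add c.lin.continuous).continuousOn
    fun v hv => c.map_dom v hv.1 hv.2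

open Classical in
/-- The induced chart of the subset. -/
noncomputable def toChart (c : AffineSliceChart I S J) (p₀ : S) : OpenPartialHomeomorph S HV where
  toFun q := J.symm (c.coord q)
  invFun h := if hS : c.point (J h) ∈ S then ⟨c.point (J h), hS⟩ else p₀
  source := Subtype.val ⁻¹' c.chart.source
  target := J ⁻¹' c.dom
  map_source' q hq := by
    have := c.coord_spec hq q.2
    rw [mem_preimage, J.right_inv this.2.1]
    exact this.1
  map_target' h hh := by
    have := c.point_spec hh (mem_range_self h)
    rw [dif_pos this.2.1]
    exact this.1
  left_inv' q hq := by
    have h1 := c.coord_spec hq q.2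
    have h2 := c.point_coord hq q.2
    rw [J.right_inv h1.2.1, dif_pos (by rw [h2]; exact q.2)]
    exact Subtype.ext h2
  right_inv' h hh := by
    have := c.point_spec hh (mem_range_self h)
    rw [dif_pos this.2.1, this.2.2.2, J.left_inv]
  open_source := c.chart.open_source.preimage continuous_subtype_val
  open_target := c.isOpen_dom.preimage J.continuous
  continuousOn_toFun := J.continuous_symm.comp_continuousOn
    (c.continuousOn_coord.comp continuous_subtype_val.continuousOn fun _ h => h)
  continuousOn_invFun := by
    rw [Topology.IsInducing.subtypeVal.continuousOn_iff]
    refine (c.continuousOn_point.comp (J.continuous.continuousOn (s := J ⁻¹' c.dom))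
      fun h hh => ⟨hh, mem_range_self h⟩).congr fun h hh => ?_
    simp only [Function.comp_apply]
    rw [dif_pos (c.point_spec hh (mem_range_self h)).2.1]

theorem coe_toChart_symm (c : AffineSliceChart I S J) (p₀ : S) {h : HV} (hh : J h ∈ c.dom) :
    ((c.toChart p₀).symm h : M) = c.point (J h) :=
  congrArg Subtype.val (dif_pos (c.point_spec hh (mem_range_self h)).2.1)

theorem contDiffOn_transition (c c' : AffineSliceChart I S J) (p₀ p₀' : S) :
    ContDiffOn ℝ ∞ (J ∘ ((c.toChart p₀).symm ≫ₕ c'.toChart p₀') ∘ J.symm)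
      (J.symm ⁻¹' ((c.toChart p₀).symm ≫ₕ c'.toChart p₀').source ∩ range J) := by
  have key : ∀ v ∈ J.symm ⁻¹' ((c.toChart p₀).symm ≫ₕ c'.toChart p₀').source ∩ range J,
      v ∈ c.dom ∧ v ∈ range J ∧ c.point v ∈ c'.chart.source ∧
      (J ∘ ((c.toChart p₀).symm ≫ₕ c'.toChart p₀') ∘ J.symm) v = c'.coord (c.point v) := by
    rintro v ⟨hv, hvJ⟩
    rw [mem_preimage, OpenPartialHomeomorph.trans_source] at hv
    have h1 : J (J.symm v) ∈ c.dom := hv.1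
    have h2 : ((c.toChart p₀).symm (J.symm v) : M) ∈ c'.chart.source := hv.2
    have h3 := c.coe_toChart_symm p₀ h1
    rw [J.right_inv hvJ] at h1 h3
    rw [h3] at h2
    refine ⟨h1, hvJ, h2, ?_⟩
    change J (J.symm (c'.coord ((c.toChart p₀).symm (J.symm v) : M))) = _
    rw [h3]
    exact J.right_inv (c'.coord_spec h2 (c.point_spec h1 hvJ).2.1).2.1
  refine ContDiffOn.congr (f := fun v => c'.coord (c.point v)) ?_ fun v hv => (key v hv).2.2.2
  have h := I.contDiffOn_extendCoordChange c.chart_mem c'.chart_mem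
  have h1 : ContDiffOn ℝ ∞ (fun v : V => c.base + c.lin v)
      (J.symm ⁻¹' ((c.toChart p₀).symm ≫ₕ c'.toChart p₀').source ∩ range J) :=
    (contDiff_const.add c.lin.contDiff).contDiffOn
  refine c'.retr.contDiff.comp_contDiffOn (ContDiffOn.sub ?_ contDiffOn_const)
  refine h.comp h1 fun v hv => ?_
  obtain ⟨h1, h2, h3, -⟩ := key v hv
  rw [ModelWithCorners.extendCoordChange, PartialEquiv.trans_source]
  refine ⟨c.map_dom v h1 h2, ?_⟩
  rw [mem_preimage, OpenPartialHomeomorph.extend_source]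
  exact h3

end AffineSliceChart

theorem isEmbeddedSubmanifold_of_affineSliceChart {E : Type*} [NormedAddCommGroup E]
    [NormedSpace ℝ E] {H : Type*} [TopologicalSpace H] {I : ModelWithCorners ℝ E H}
    {M : Type*} [TopologicalSpace M] [ChartedSpace H M] [T2Space M] [SecondCountableTopology M]
    {S : Set M} {k : ℕ} {HV : Type} [TopologicalSpace HV]
    {J : ModelWithCorners ℝ (EuclideanSpace ℝ (Fin k)) HV} (hJ : IsBoundaryModel J)
    (h : ∀ p ∈ S, ∃ c : AffineSliceChart I S J, p ∈ c.chart.source) :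
    IsEmbeddedSubmanifold I S := by
  choose c hc using fun p : S => h p p.2
  let : ChartedSpace HV S :=
    { atlas := range fun p => (c p).toChart p
      chartAt := fun p => (c p).toChart p
      mem_chart_source := fun p => hc p
      chart_mem_atlas := fun p => mem_range_self p }
  have hman : IsManifold J ∞ S := isManifold_of_contDiffOn J ∞ S (by
    rintro _ _ ⟨p, rfl⟩ ⟨p', rfl⟩
    exact (c p).contDiffOn_transition (c p') p p')
  refine ⟨{ dim := k, Model := HV, model := J, isSmoothManifold := ?_, adapted := fun p => ?_ }⟩
  · exact ⟨inferInstance, hJ, inferInstance, inferInstance, hman⟩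
  · refine ⟨(c p).toChart p, IsManifold.subset_maximalAtlas (mem_range_self p), (c p).chart,
      (c p).chart_mem,
      ((c p).lin : EuclideanSpace ℝ (Fin k) →ₗ[ℝ] E).toAffineMap +
        AffineMap.const ℝ _ (c p).base, hc p, fun q hq => hq, ?_, ?_⟩
    · intro v w hvw
      have : (c p).lin v = (c p).lin w := by simpa using hvw
      rw [← (c p).retr_lin v, this, (c p).retr_lin]
    · intro v hv
      rw [OpenPartialHomeomorph.extend_target] at hv
      have h1 : J (J.symm v) ∈ (c p).dom := hv.1
      have h3 := (c p).coe_toChart_symm p h1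
      rw [J.right_inv hv.2] at h1 h3
      change (c p).chart.extend I (((c p).toChart p).symm (J.symm v) : M) = _
      rw [h3, ((c p).point_spec h1 hv.2).2.2.1]
      simp [add_comm]

theorem LinearEquiv.exists_comp_eq_of_ne_zero {K V W : Type*} [Field K] [AddCommGroup V]
    [Module K V] [AddCommGroup W] [Module K W] [FiniteDimensional K V] [FiniteDimensional K W]
    (h : Module.finrank K V = Module.finrank K W) {f : V →ₗ[K] K} (hf : f ≠ 0)
    {g : W →ₗ[K] K} (hg : g ≠ 0) : ∃ ε : V ≃ₗ[K] W, ∀ v, g (ε v) = f v := by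
  obtain ⟨v₁, hv₁⟩ := LinearMap.surjective hf 1
  obtain ⟨w₁, hw₁⟩ := LinearMap.surjective hg 1
  have hker : Module.finrank K (LinearMap.ker f) = Module.finrank K (LinearMap.ker g) := by
    have h1 := Module.Dual.finrank_ker_add_one_of_ne_zero (f := f) hf
    have h2 := Module.Dual.finrank_ker_add_one_of_ne_zero (f := g) hg
    omega
  let ε₀ := LinearEquiv.ofFinrankEq _ _ hker
  let P : V →ₗ[K] LinearMap.ker f :=
    LinearMap.codRestrict _ (LinearMap.id - f.smulRight v₁) fun v => by simp [hv₁]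
  let F : V →ₗ[K] W := (LinearMap.ker g).subtype ∘ₗ ε₀.toLinearMap ∘ₗ P + f.smulRight w₁
  have hF : ∀ v, F v = (ε₀ (P v) : W) + f v • w₁ := fun v => rfl
  have hgF : ∀ v, g (F v) = f v := fun v => by
    have : g (ε₀ (P v) : W) = 0 := (ε₀ (P v)).2
    rw [hF, _root_.map_add, this, _root_.map_smul, hw₁]; simp
  have hinj : Function.Injective F := by
    rw [← LinearMap.ker_eq_bot, LinearMap.ker_eq_bot']
    intro v hv
    have h1 : f v = 0 := by rw [← hgF, hv, map_zero]
    have h2 : (ε₀ (P v) : W) = 0 := by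
      have := hF v
      rwa [hv, h1, zero_smul, add_zero, eq_comm] at this
    have h3 : P v = 0 := ε₀.map_eq_zero_iff.1 (Subtype.ext h2)
    have h4 : v - f v • v₁ = 0 := congrArg Subtype.val h3
    rwa [h1, zero_smul, sub_zero] at h4
  exact ⟨LinearMap.linearEquivOfInjective F hinj h, hgF⟩

theorem Submodule.exists_continuousLinear_embedding {V E : Type*} [NormedAddCommGroup V]
    [NormedSpace ℝ V] [FiniteDimensional ℝ V] [NormedAddCommGroup E] [NormedSpace ℝ E]
    [FiniteDimensional ℝ E] {K : Submodule ℝ E} (ε : V ≃ₗ[ℝ] K) :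
    ∃ (ι : V →L[ℝ] E) (g : E →L[ℝ] V), (∀ v, g (ι v) = v) ∧ (∀ v, ι v = ε v) ∧
      ∀ y ∈ K, ι (g y) = y := by
  have hinj : LinearMap.ker (K.subtype ∘ₗ ε.toLinearMap) = ⊥ :=
    LinearMap.ker_eq_bot.2 (K.injective_subtype.comp ε.injective)
  obtain ⟨g, hg⟩ := LinearMap.exists_leftInverse_of_injective _ hinj
  have hg' : ∀ v, g (ε v : E) = v := fun v => LinearMap.congr_fun hg v
  refine ⟨LinearMap.toContinuousLinearMap (K.subtype ∘ₗ ε.toLinearMap),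
    LinearMap.toContinuousLinearMap g, hg', fun v => rfl, fun y hy => ?_⟩
  change (ε (g y) : E) = y
  have := hg' (ε.symm ⟨y, hy⟩)
  rw [ε.apply_symm_apply] at this
  change g y = _ at this
  rw [this, ε.apply_symm_apply]

section

variable {E : Type*} [NormedAddCommGroup E] [NormedSpace ℝ E] [FiniteDimensional ℝ E]
    {H : Type*} [TopologicalSpace H] {I : ModelWithCorners ℝ E H}
    {M : Type*} [TopologicalSpace M] [ChartedSpace H M] {S : Set M}
    {V : Type*} [NormedAddCommGroup V] [NormedSpace ℝ V] [FiniteDimensional ℝ V]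
    {HV : Type*} [TopologicalSpace HV] {J : ModelWithCorners ℝ V HV}

theorem exists_affineSliceChart_of_transversal {ℓ : E →L[ℝ] ℝ} (hI : range I = {v | 0 ≤ ℓ v})
    {μ : V →L[ℝ] ℝ} (hμ : μ ≠ 0) (hJ : range J = {v | 0 ≤ μ v})
    {ψ : OpenPartialHomeomorph M H} (hψ : ψ ∈ IsManifold.maximalAtlas I ∞ M) {p : M}
    (hp : p ∈ ψ.source) {K : Submodule ℝ E} (hK : Module.finrank ℝ V = Module.finrank ℝ K)
    (hS : ∀ q ∈ ψ.source, q ∈ S ↔ ψ.extend I q - ψ.extend I p ∈ K)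
    (h0 : ℓ (ψ.extend I p) = 0) (hKℓ : ¬ K ≤ LinearMap.ker (ℓ : E →ₗ[ℝ] ℝ)) :
    ∃ c : AffineSliceChart I S J, p ∈ c.chart.source := by
  obtain ⟨ε, hε⟩ := LinearEquiv.exists_comp_eq_of_ne_zero (f := (μ : V →ₗ[ℝ] ℝ))
    (g := (ℓ : E →ₗ[ℝ] ℝ) ∘ₗ K.subtype) hK
    (fun h => hμ (ContinuousLinearMap.ext fun v => LinearMap.congr_fun h v))
    (fun h => hKℓ fun y hy => LinearMap.congr_fun h ⟨y, hy⟩)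
  obtain ⟨ι, g, hg, hι, hιg⟩ := Submodule.exists_continuousLinear_embedding ε
  have hℓι : ∀ v, ℓ (ι v) = μ v := fun v => by rw [hι]; exact hε v
  set a := ψ.extend I p with ha
  refine ⟨{ chart := ψ, chart_mem := hψ, base := a, lin := ι, retr := g, retr_lin := hg
            dom := (fun v => a + ι v) ⁻¹' (I.symm ⁻¹' ψ.target)
            isOpen_dom := ?_, map_dom := ?_, mem_iff := ?_ }, hp⟩
  · exact (ψ.open_target.preimage I.continuous_symm).preimage (continuous_const.add ι.continuous)
  · intro v hv hvJ
    rw [OpenPartialHomeomorph.extend_target]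
    refine ⟨hv, hI.symm.subset ?_⟩
    have : 0 ≤ μ v := hJ.subset hvJ
    simpa [h0, hℓι] using this
  · intro q hq
    rw [hS q hq]
    constructor
    · intro h
      have h1 : a + ι (g (ψ.extend I q - a)) = ψ.extend I q := by rw [hιg _ h]; abel
      refine ⟨g (ψ.extend I q - a), ?_, hJ.symm.subset ?_, h1⟩
      · rw [mem_preimage, mem_preimage, h1]
        change I.symm (I (ψ q)) ∈ ψ.target
        rw [I.left_inv]
        exact ψ.map_source hq
      · change 0 ≤ μ _
        rw [← hℓι, hιg _ h, map_sub, h0, sub_zero]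
        exact hI.subset (mem_range_self (ψ q))
    · rintro ⟨v, -, -, hv⟩
      rw [← hv, add_sub_cancel_left, hι]
      exact (ε v).2

theorem exists_affineSliceChart_of_not_transversal {ℓ : E →L[ℝ] ℝ}
    (hI : range I = {v | 0 ≤ ℓ v})
    {ψ : OpenPartialHomeomorph M H} (hψ : ψ ∈ IsManifold.maximalAtlas I ∞ M) {p : M}
    (hp : p ∈ ψ.source) {K : Submodule ℝ E} (hK : Module.finrank ℝ V = Module.finrank ℝ K)
    (hS : ∀ q ∈ ψ.source, q ∈ S ↔ ψ.extend I q - ψ.extend I p ∈ K)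
    (h0 : ℓ (ψ.extend I p) = 0 → K ≤ LinearMap.ker (ℓ : E →ₗ[ℝ] ℝ)) [IsManifold I ∞ M] :
    ∃ c : AffineSliceChart I S J, p ∈ c.chart.source := by
  obtain ⟨ι, g, hg, hι, hιg⟩ :=
    Submodule.exists_continuousLinear_embedding (LinearEquiv.ofFinrankEq V K hK)
  have hιK : ∀ v, ι v ∈ K := fun v => by rw [hι]; exact Subtype.coe_prop _
  obtain ⟨e₀, he₀⟩ := J.nonempty_interior
  set a := ψ.extend I p with ha
  have ha0 : 0 ≤ ℓ a := hI.subset (mem_range_self (ψ p))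
  let N : Set E := {y | ℓ a ≠ 0 → 0 < ℓ y}
  have hNo : IsOpen N := by
    by_cases h : ℓ a = 0
    · simp [N, h]
    · simpa [N, h] using isOpen_lt continuous_const ℓ.continuous
  have haN : a ∈ N := fun h => lt_of_le_of_ne ha0 h.symm
  let T : Set E := (fun y => e₀ + g (y - a)) ⁻¹' interior (range J) ∩ N
  have hTo : IsOpen T := (isOpen_interior.preimage
    (continuous_const.add (g.continuous.comp (continuous_id.sub continuous_const)))).inter hNo
  let s : Set M := ψ.source ∩ ψ.extend I ⁻¹' T
  have hso : IsOpen s := by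
    have := ψ.continuousOn_extend (I := I)
    rw [OpenPartialHomeomorph.extend_source] at this
    exact this.isOpen_inter_preimage ψ.open_source hTo
  have hsrc : (ψ.restr s).source = s := by
    rw [ψ.restr_source, hso.interior_eq]; exact inter_eq_right.2 inter_subset_left
  refine ⟨{ chart := ψ.restr s
            chart_mem := restr_mem_maximalAtlas (contDiffGroupoid ∞ I) hψ hso
            base := a - ι e₀, lin := ι, retr := g, retr_lin := hg
            dom := interior (range J) ∩
              (fun v => a - ι e₀ + ι v) ⁻¹' ((I.symm ⁻¹' ψ.target) ∩ N)
            isOpen_dom := ?_, map_dom := ?_, mem_iff := ?_ }, ?_⟩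
  · exact isOpen_interior.inter (((ψ.open_target.preimage I.continuous_symm).inter hNo).preimage
      (continuous_const.add ι.continuous))
  · rintro v ⟨hvJ, hvt, hvN⟩ -
    set y := a - ι e₀ + ι v with hy
    have hya : y - a = ι (v - e₀) := by rw [hy, map_sub]; abel
    have hyI : y ∈ range I := by
      refine hI.symm.subset ?_
      by_cases h : ℓ a = 0
      · have : ℓ (y - a) = 0 := by rw [hya]; exact h0 h (hιK _)
        rw [map_sub, sub_eq_zero] at this
        exact ha0.trans_eq this.symm
      · exact (hvN h).le
    have hyt : y ∈ (ψ.extend I).target := by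
      rw [OpenPartialHomeomorph.extend_target]; exact ⟨hvt, hyI⟩
    set q := (ψ.extend I).symm y with hq
    have hqs : q ∈ ψ.source := by
      have := (ψ.extend I).map_target hyt
      rwa [OpenPartialHomeomorph.extend_source] at this
    have hqy : ψ.extend I q = y := (ψ.extend I).right_inv hyt
    have hqs' : q ∈ s := by
      refine ⟨hqs, ?_⟩
      rw [mem_preimage, hqy]
      refine ⟨?_, hvN⟩
      rw [mem_preimage, hya, hg, add_sub_cancel]
      exact hvJ
    rw [OpenPartialHomeomorph.extend_target_eq_image_source]
    exact ⟨q, by rwa [hsrc], hqy⟩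
  · intro q hq
    rw [hsrc] at hq
    change q ∈ S ↔ ∃ v ∈ _, v ∈ range J ∧ a - ι e₀ + ι v = ψ.extend I q
    rw [hS q hq.1]
    constructor
    · intro h
      have h1 : a - ι e₀ + ι (e₀ + g (ψ.extend I q - a)) = ψ.extend I q := by
        rw [map_add, hιg _ h]; abel
      have h2 : e₀ + g (ψ.extend I q - a) ∈ interior (range J) := hq.2.1
      refine ⟨e₀ + g (ψ.extend I q - a), ⟨h2, ?_⟩, interior_subset h2, h1⟩
      rw [mem_preimage, h1]
      refine ⟨?_, hq.2.2⟩
      simp only [mem_preimage, OpenPartialHomeomorph.extend_coe, Function.comp_apply,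
          I.left_inv]
      exact ψ.map_source hq.1
    · rintro ⟨v, -, -, hv⟩
      have : ψ.extend I q - a = ι (v - e₀) := by rw [← hv, map_sub]; abel
      rw [this]
      exact hιK _
  · rw [hsrc]
    refine ⟨hp, ?_, haN⟩
    rw [mem_preimage, ← ha, sub_self, map_zero, add_zero]
    exact he₀

/-- The model of `k`-dimensional manifolds with boundary. -/
theorem exists_boundary_model (k : ℕ) : ∃ (HV : Type) (_ : TopologicalSpace HV)
    (J : ModelWithCorners ℝ (EuclideanSpace ℝ (Fin k)) HV), IsBoundaryModel J ∧
      (k ≠ 0 → ∃ μ : EuclideanSpace ℝ (Fin k) →L[ℝ] ℝ, μ ≠ 0 ∧ range J = {v | 0 ≤ μ v}) := by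
  rcases k with _ | n
  · exact ⟨EuclideanSpace ℝ (Fin 0), inferInstance, 𝓡 0, Or.inl (by simp), fun h => absurd rfl h⟩
  · have h : ∃ μ : EuclideanSpace ℝ (Fin (n + 1)) →L[ℝ] ℝ, μ ≠ 0 ∧
        range (𝓡∂ (n + 1)) = {v | 0 ≤ μ v} := by
      refine ⟨EuclideanSpace.proj 0, fun h => ?_,
        range_modelWithCornersEuclideanHalfSpace (n + 1)⟩
      have := DFunLike.congr_fun h (EuclideanSpace.single 0 1)
      simp at this
    exact ⟨EuclideanHalfSpace (n + 1), inferInstance, 𝓡∂ (n + 1), Or.inr h, fun _ => h⟩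

/-- A subset which in charts around each of its points is a piece of an affine subspace of
dimension `k` is an embedded submanifold. -/
theorem isEmbeddedSubmanifold_of_submodule [T2Space M] [SecondCountableTopology M]
    [IsManifold I ∞ M] {ℓ : E →L[ℝ] ℝ} (hI : range I = {v | 0 ≤ ℓ v}) (k : ℕ)
    (h : ∀ p ∈ S, ∃ ψ ∈ IsManifold.maximalAtlas I ∞ M, ∃ K : Submodule ℝ E, p ∈ ψ.source ∧
      Module.finrank ℝ K = k ∧ ∀ q ∈ ψ.source, q ∈ S ↔ ψ.extend I q - ψ.extend I p ∈ K) :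
    IsEmbeddedSubmanifold I S := by
  obtain ⟨HV, _, J, hJ, hJ'⟩ := exists_boundary_model k
  refine isEmbeddedSubmanifold_of_affineSliceChart (k := k) (J := J) hJ fun p hp => ?_
  obtain ⟨ψ, hψ, K, hpψ, hK, hS⟩ := h p hp
  have hVK : Module.finrank ℝ (EuclideanSpace ℝ (Fin k)) = Module.finrank ℝ K := by simp [hK]
  by_cases hc : ℓ (ψ.extend I p) = 0 ∧ ¬ K ≤ LinearMap.ker (ℓ : E →ₗ[ℝ] ℝ)
  · obtain ⟨μ, hμ, hJμ⟩ := hJ' fun h0 => hc.2 (by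
      rw [Submodule.finrank_eq_zero.1 (hK.trans h0)]; exact bot_le)
    exact exists_affineSliceChart_of_transversal hI hμ hJμ hψ hpψ hVK hS hc.1 hc.2
  · exact exists_affineSliceChart_of_not_transversal hI hψ hpψ hVK hS
      fun h0 => by_contra fun hn => hc ⟨h0, hn⟩

end

/-! ### Smooth maps into embedded submanifolds -/

namespace EmbeddedSubmanifold

variable {E : Type*} [NormedAddCommGroup E] [NormedSpace ℝ E] [FiniteDimensional ℝ E]
    {H : Type*} [TopologicalSpace H] {I : ModelWithCorners ℝ E H}
    {M : Type*} [TopologicalSpace M] [ChartedSpace H M] {S : Set M}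
    {EN : Type*} [NormedAddCommGroup EN] [NormedSpace ℝ EN]
    {HN : Type*} [TopologicalSpace HN] {IN : ModelWithCorners ℝ EN HN}
    {N : Type*} [TopologicalSpace N] [ChartedSpace HN N]

theorem exists_charts (𝒮 : EmbeddedSubmanifold I S) (p : S) :
    ∃ φ ∈ IsManifold.maximalAtlas 𝒮.model ∞ S, ∃ ψ ∈ IsManifold.maximalAtlas I ∞ M,
    ∃ (a : E) (ι : EuclideanSpace ℝ (Fin 𝒮.dim) →L[ℝ] E) (g : E →L[ℝ] EuclideanSpace ℝ (Fin 𝒮.dim)),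
      p ∈ φ.source ∧ MapsTo (Subtype.val : S → M) φ.source ψ.source ∧ (∀ v, g (ι v) = v) ∧
      ∀ q ∈ φ.source, a + ι (φ.extend 𝒮.model q) = ψ.extend I (q : M) := by
  obtain ⟨φ, hφ, ψ, hψ, A, hp, hmaps, hA, hEq⟩ := 𝒮.adapted p
  have hlin : Function.Injective A.linear := A.linear_injective_iff.2 hA
  obtain ⟨g, hg⟩ := LinearMap.exists_leftInverse_of_injective _ (LinearMap.ker_eq_bot.2 hlin)
  refine ⟨φ, hφ, ψ, hψ, A 0, LinearMap.toContinuousLinearMap A.linear,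
    LinearMap.toContinuousLinearMap g, hp, hmaps, fun v => LinearMap.congr_fun hg v,
    fun q hq => ?_⟩
  have hq' : φ.extend 𝒮.model q ∈ (φ.extend 𝒮.model).target :=
    (φ.extend 𝒮.model).map_source (by rwa [OpenPartialHomeomorph.extend_source])
  have h := hEq hq'
  rw [Function.comp_apply, Function.comp_apply, φ.extend_left_inv hq] at h
  rw [h, A.decomp]
  simp [add_comm]

theorem contMDiff_val (𝒮 : EmbeddedSubmanifold I S) :
    ContMDiff 𝒮.model I ∞ (Subtype.val : S → M) := by
  intro p
  obtain ⟨φ, hφ, ψ, hψ, a, ι, g, hp, hmaps, -, hval⟩ := 𝒮.exists_charts p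
  have h1 : ContMDiffAt 𝒮.model 𝓘(ℝ, E) ∞ (fun q => a + ι (φ.extend 𝒮.model q)) p :=
    ((contDiff_const.add ι.contDiff).contMDiff.contMDiffAt (f := fun v => a + ι v)).comp p
      (φ.contMDiffAt_extend hφ hp)
  have hmem : ∀ q ∈ φ.source, a + ι (φ.extend 𝒮.model q) ∈ I '' ψ.target := fun q hq => by
    rw [hval q hq]
    exact ⟨ψ q, ψ.map_source (hmaps hq), rfl⟩
  have h3 : ContMDiffWithinAt 𝒮.model I ∞
      ((ψ.extend I).symm ∘ fun q => a + ι (φ.extend 𝒮.model q)) φ.source p :=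
    (contMDiffOn_extend_symm hψ _ (hmem p hp)).comp p h1.contMDiffWithinAt hmem
  refine (h3.contMDiffAt (φ.open_source.mem_nhds hp)).congr_of_eventuallyEq ?_
  filter_upwards [φ.open_source.mem_nhds hp] with q hq
  rw [Function.comp_apply, hval q hq, ψ.extend_left_inv (hmaps hq)]

theorem contMDiff_of_val_comp (𝒮 : EmbeddedSubmanifold I S) {f : N → S}
    (hf : ContMDiff IN I ∞ fun x => (f x : M)) : ContMDiff IN 𝒮.model ∞ f := by
  intro x
  have hcont : Continuous f := hf.continuous.subtype_mk _
  obtain ⟨φ, hφ, ψ, hψ, a, ι, g, hp, hmaps, hg, hval⟩ := 𝒮.exists_charts (f x)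
  have hval' : ∀ q ∈ φ.source, g (ψ.extend I (q : M) - a) = φ.extend 𝒮.model q := fun q hq => by
    rw [← hval q hq, add_sub_cancel_left, hg]
  have h1 : ContMDiffAt IN 𝓘(ℝ, EuclideanSpace ℝ (Fin 𝒮.dim)) ∞
      (fun y => g (ψ.extend I (f y : M) - a)) x :=
    ((g.contDiff.comp (contDiff_id.sub contDiff_const)).contMDiff.contMDiffAt
      (f := fun v => g (v - a))).comp x ((ψ.contMDiffAt_extend hψ (hmaps hp)).comp x (hf x))
  have hs : f ⁻¹' φ.source ∈ 𝓝 x := hcont.continuousAt.preimage_mem_nhds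
    (φ.open_source.mem_nhds hp)
  have hmem : ∀ y ∈ f ⁻¹' φ.source, g (ψ.extend I (f y : M) - a) ∈ 𝒮.model '' φ.target :=
    fun y hy => by
      rw [hval' _ hy]
      exact ⟨φ (f y), φ.map_source hy, rfl⟩
  have h3 : ContMDiffWithinAt IN 𝒮.model ∞
      ((φ.extend 𝒮.model).symm ∘ fun y => g (ψ.extend I (f y : M) - a)) (f ⁻¹' φ.source) x :=
    (contMDiffOn_extend_symm hφ _ (hmem x hp)).comp x h1.contMDiffWithinAt hmem
  refine (h3.contMDiffAt hs).congr_of_eventuallyEq ?_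
  filter_upwards [hs] with y hy
  rw [Function.comp_apply, hval' _ hy, φ.extend_left_inv hy]

end EmbeddedSubmanifold

namespace CategoryStructure

theorem isLieMonoid_homSet {E : Type*} [NormedAddCommGroup E] [NormedSpace ℝ E]
    {H : Type*} [TopologicalSpace H] {I : ModelWithCorners ℝ E H} {m : ℕ}
    {C : Type*} [TopologicalSpace C] [ChartedSpace H C]
    {X : Type*} [TopologicalSpace X] [ChartedSpace (EuclideanSpace ℝ (Fin m)) X]
    {𝒞 : CategoryStructure C X} (h𝒞 : 𝒞.IsLieCategory I m) (x : X)
    (S : EmbeddedSubmanifold I (𝒞.homSet x x)) : IsLieMonoid S.model (𝒞.homSet x x) := by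
  have := h𝒞.isSmoothManifold.finiteDimensional
  have := S.isSmoothManifold.isManifold
  refine ⟨S.isSmoothManifold, { contMDiff_mul := S.contMDiff_of_val_comp ?_ }⟩
  have hcomp : ∀ p : 𝒞.homSet x x × 𝒞.homSet x x, ((p.1 : C), (p.2 : C)) ∈ 𝒞.composable :=
    fun p => p.1.2.1.trans p.2.2.2.symm
  have h1 : ContMDiff (S.model.prod S.model) (I.prod I) ∞
      fun p : 𝒞.homSet x x × 𝒞.homSet x x => ((p.1 : C), (p.2 : C)) :=
    (S.contMDiff_val.comp contMDiff_fst).prodMk (S.contMDiff_val.comp contMDiff_snd)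
  refine (h𝒞.comp_smooth.comp_contMDiff h1 hcomp).congr fun p => ?_
  exact (dif_pos (hcomp p)).symm

end CategoryStructure

/-! ### Curves in level sets and tangent maps of translations -/

section Curves

variable {E : Type*} [NormedAddCommGroup E] [NormedSpace ℝ E]
  {F : Type*} [NormedAddCommGroup F] [NormedSpace ℝ F]

theorem HasFDerivWithinAt.comp_curve {f : E → F} {f' : E →L[ℝ] F} {A : Set E} {x w : E}
    (hf : HasFDerivWithinAt f f' A x) {γ : ℝ → E} (hγ : HasDerivWithinAt γ w (Ici 0) 0)
    (h0 : γ 0 = x) (hA : ∀ᶠ r in 𝓝[≥] (0 : ℝ), γ r ∈ A) :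
    HasDerivWithinAt (fun r => f (γ r)) (f' w) (Ici 0) 0 := by
  subst h0
  have h := hf.comp_of_tendsto 0 hγ.hasFDerivWithinAt
    (tendsto_nhdsWithin_of_tendsto_nhds_of_eventually_within _ hγ.continuousWithinAt hA)
  have h' := h.hasDerivWithinAt
  rwa [ContinuousLinearMap.comp_apply, ContinuousLinearMap.toSpanSingleton_apply, one_smul] at h'

theorem HasDerivWithinAt.unique_of_eventuallyEq {f g : ℝ → F} {a b : F}
    (hf : HasDerivWithinAt f a (Ici 0) 0) (hg : HasDerivWithinAt g b (Ici 0) 0)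
    (h : ∀ᶠ r in 𝓝[≥] (0 : ℝ), f r = g r) : a = b :=
  (uniqueDiffOn_Ici (0 : ℝ) 0 self_mem_Ici).eq_deriv _ hf
    (hg.congr_of_eventuallyEq h (h.self_of_nhdsWithin self_mem_Ici))

theorem HasDerivWithinAt.nonneg_of_eventually {f : ℝ → ℝ} {a : ℝ}
    (hf : HasDerivWithinAt f a (Ici 0) 0) (h0 : f 0 = 0)
    (h : ∀ᶠ r in 𝓝[≥] (0 : ℝ), 0 ≤ f r) : 0 ≤ a := by
  have h1 := hasDerivWithinAt_iff_tendsto_slope.1 hf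
  rw [Ici_sdiff_left] at h1
  refine ge_of_tendsto h1 ?_
  filter_upwards [nhdsWithin_mono 0 Ioi_subset_Ici_self h, self_mem_nhdsWithin] with r hr hr0
  rw [slope_def_field, h0, sub_zero, sub_zero]
  exact div_nonneg hr (le_of_lt hr0)

/-- Every inward vector in the kernel of a submersion is the velocity of a curve in a fibre. -/
theorem exists_curve_in_fiber [FiniteDimensional ℝ E] [FiniteDimensional ℝ F]
    (ℓ : E →L[ℝ] ℝ) {U : Set E} (hU : IsOpen U)
    {p : E} (hp : 0 ≤ ℓ p) (hpU : p ∈ U) {Φ : E → F}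
    (hΦ : ContDiffOn ℝ ∞ Φ ({v | 0 ≤ ℓ v} ∩ U))
    (hsurj : ∀ w, ∃ v, (ℓ p = 0 → ℓ v = 0) ∧ fderivWithin ℝ Φ {v | 0 ≤ ℓ v} p v = w)
    {w : E} (hw : fderivWithin ℝ Φ {v | 0 ≤ ℓ v} p w = 0) (hwℓ : ℓ p = 0 → 0 ≤ ℓ w) :
    ∃ γ : ℝ → E, γ 0 = p ∧ HasDerivWithinAt γ w (Ici 0) 0 ∧
      ∀ᶠ r in 𝓝[≥] (0 : ℝ), γ r ∈ U ∧ 0 ≤ ℓ (γ r) ∧ Φ (γ r) = Φ p := by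
  set D := fderivWithin ℝ Φ {v | 0 ≤ ℓ v} p with hD
  let V : Submodule ℝ E := if ℓ p = 0 then LinearMap.ker (ℓ : E →ₗ[ℝ] ℝ) else ⊤
  have hV : ∀ v, v ∈ V ↔ (ℓ p = 0 → ℓ v = 0) := fun v => by
    by_cases h0 : ℓ p = 0 <;> simp [V, h0]
  obtain ⟨L₀, hL0V, hL0, hL01, -⟩ := LinearMap.exists_outer_inverse
    (D : E →ₗ[ℝ] F) V ⊥ (by
      refine eq_top_iff.2 fun f _ => Submodule.mem_sup_left ?_
      obtain ⟨v, hv, hvf⟩ := hsurj f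
      exact ⟨v, (hV v).2 hv, hvf⟩)
  set L : F →L[ℝ] E := LinearMap.toContinuousLinearMap L₀ with hLdef
  have hL : ∀ f, L (D (L f)) = L f := hL0
  have hL1 : ∀ f, L f = 0 → f = 0 := hL01
  have hℓL : ℓ p = 0 → ∀ f, ℓ (L f) = 0 := fun h0 f => (hV _).1 (hL0V f) h0
  obtain ⟨e, he, heU, hpe, heΦ, heA⟩ :=
    exists_outer_straightening ℓ hU hp hpU hΦ hD.symm L hℓL
  have hep : e p = p := by rw [heΦ p hpe hp]; simp
  have hpt : p ∈ e.target := by rw [← hep]; exact e.map_source hpe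
  obtain ⟨A, hA, hAe⟩ := heA p hpe hp
  have hA1 : A = ContinuousLinearEquiv.refl ℝ E := by
    ext w
    rw [hA, ← hD]; simp
  rw [hA1, hep] at hAe
  have hline : HasDerivWithinAt (fun r : ℝ => p + r • w) w (Ici 0) 0 := by
    have := ((hasDerivAt_id (0 : ℝ)).smul_const w).const_add p
    simpa using this.hasDerivWithinAt
  have hc : ContinuousAt (fun r : ℝ => p + r • w) 0 := by fun_prop
  have hin : ∀ᶠ r in 𝓝[≥] (0 : ℝ), 0 ≤ ℓ (p + r • w) := by
    by_cases h0 : ℓ p = 0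
    · filter_upwards [self_mem_nhdsWithin] with r hr
      rw [map_add, map_smul, h0, zero_add]
      exact mul_nonneg hr (hwℓ h0)
    · have hpos : 0 < ℓ (p + (0 : ℝ) • w) := by
        simpa using lt_of_le_of_ne hp (Ne.symm h0)
      have : ContinuousAt (fun r : ℝ => ℓ (p + r • w)) 0 := by fun_prop
      exact nhdsWithin_le_nhds ((this.eventually_const_lt hpos).mono fun r hr => hr.le)
  have hct : ∀ᶠ r in 𝓝[≥] (0 : ℝ), p + r • w ∈ e.target :=
    nhdsWithin_le_nhds (hc.eventually_mem (by simpa using e.open_target.mem_nhds hpt))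
  refine ⟨fun r => e.symm (p + r • w), ?_, ?_, ?_⟩
  · simp only [zero_smul, add_zero]
    rw [← hep, e.left_inv hpe, hep]
  · simpa using hAe.comp_curve hline (by simp) hin
  · filter_upwards [hin, hct] with r hr hrt
    obtain ⟨h1, h2⟩ := he.mapsTo_symm ⟨hr, hrt⟩
    refine ⟨heU h2, h1, ?_⟩
    have h3 := outer_straightening_apply hL (Φ (e.symm (p + r • w)) - Φ p)
      (e.symm (p + r • w) - p)
    have h4 := heΦ _ h2 h1
    rw [e.right_inv hrt] at h4
    have h5 : e.symm (p + r • w) - p +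
        L (Φ (e.symm (p + r • w)) - Φ p - D (e.symm (p + r • w) - p)) = r • w := by
      rw [← sub_eq_iff_eq_add'.2 h4]; abel
    rw [h5, map_smul, hw, smul_zero, map_zero] at h3
    exact sub_eq_zero.1 (hL1 _ h3.symm)

/-- Surjectivity of the differential, also along the boundary, is an open condition. -/
theorem exists_nhds_surjective [FiniteDimensional ℝ E] [FiniteDimensional ℝ F]
    (ℓ : E →L[ℝ] ℝ) {U : Set E} (hU : IsOpen U)
    {p : E} (hp : 0 ≤ ℓ p) (hpU : p ∈ U) {Φ : E → F}
    (hΦ : ContDiffOn ℝ ∞ Φ ({v | 0 ≤ ℓ v} ∩ U))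
    (hsurj : ∀ w, ∃ v, (ℓ p = 0 → ℓ v = 0) ∧ fderivWithin ℝ Φ {v | 0 ≤ ℓ v} p v = w) :
    ∃ U' ⊆ U, IsOpen U' ∧ p ∈ U' ∧ ∀ z ∈ U', 0 ≤ ℓ z →
      ∀ w, ∃ v, (ℓ z = 0 → ℓ v = 0) ∧ fderivWithin ℝ Φ {v | 0 ≤ ℓ v} z v = w := by
  set Q : Set E := {v | 0 ≤ ℓ v} with hQ
  set D := fderivWithin ℝ Φ Q p with hD
  have hu := uniqueDiffOn_halfSpace_inter ℓ hU
  have heq : ∀ z ∈ U, fderivWithin ℝ Φ (Q ∩ U) z = fderivWithin ℝ Φ Q z := fun z hz =>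
    fderivWithin_inter (hU.mem_nhds hz)
  let V : Submodule ℝ E := if ℓ p = 0 then LinearMap.ker (ℓ : E →ₗ[ℝ] ℝ) else ⊤
  have hV : ∀ v, v ∈ V ↔ (ℓ p = 0 → ℓ v = 0) := fun v => by
    by_cases h0 : ℓ p = 0 <;> simp [V, h0]
  obtain ⟨L₀, hL0V, hL0, hL01, -⟩ := LinearMap.exists_outer_inverse
    (D : E →ₗ[ℝ] F) V ⊥ (by
      refine eq_top_iff.2 fun f _ => Submodule.mem_sup_left ?_
      obtain ⟨v, hv, hvf⟩ := hsurj f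
      exact ⟨v, (hV v).2 hv, hvf⟩)
  set L : F →L[ℝ] E := LinearMap.toContinuousLinearMap L₀ with hLdef
  have hDL : D.comp L = ContinuousLinearMap.id ℝ F := by
    ext f
    have h1 : L (D (L f) - f) = 0 := by
      rw [map_sub, sub_eq_zero]; exact hL0 f
    have h2 : D (L f) - f = 0 := hL01 _ h1
    exact sub_eq_zero.1 h2
  have hcont : ContinuousOn (fun z => (fderivWithin ℝ Φ (Q ∩ U) z).comp L) (Q ∩ U) :=
    (hΦ.continuousOn_fderivWithin hu (by simp)).clm_comp continuousOn_const
  have hev := Metric.tendsto_nhds.1 (hcont p ⟨hp, hpU⟩) (1 / 2) (by norm_num)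
  rw [eventually_nhdsWithin_iff] at hev
  have hev2 : ∀ᶠ z in 𝓝 p, ℓ p ≠ 0 → ℓ z ≠ 0 := by
    by_cases h0 : ℓ p = 0
    · simp [h0]
    · filter_upwards [ℓ.continuous.continuousAt.eventually_ne h0] with z hz _ using hz
  obtain ⟨U', hU', hU'o, hpU'⟩ :=
    eventually_nhds_iff.1 ((hev.and hev2).and (hU.mem_nhds hpU))
  refine ⟨U', fun z hz => (hU' z hz).2, hU'o, hpU', fun z hz hz0 w => ?_⟩
  obtain ⟨⟨h1, h2⟩, h3⟩ := hU' z hz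
  have h4 := h1 ⟨hz0, h3⟩
  beta_reduce at h4
  rw [heq z h3, heq p hpU, ← hD, hDL, dist_eq_norm] at h4
  obtain ⟨A, hA⟩ := exists_continuousLinearEquiv_of_norm_sub_id_lt _ (by norm_num) h4.le
  refine ⟨L (A.symm w), fun h0 => (hV _).1 (hL0V _) (by_contra fun h => h2 h h0), ?_⟩
  have := DFunLike.congr_fun hA (A.symm w)
  simpa using this.symm

/-- The tangent map of a translation, on one inward vector. -/
theorem translation_tangent_apply
    {F' : Type*} [NormedAddCommGroup F'] [NormedSpace ℝ F']
    (ℓ : E →L[ℝ] ℝ) {a z w : E} {γ : ℝ → E} (hγ0 : γ 0 = a)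
    (hγ : HasDerivWithinAt γ w (Ici 0) 0) {A B : Set E}
    {Λ : E → E} {L : E →L[ℝ] E} (hΛ : HasFDerivWithinAt Λ L A a) (hΛa : Λ a = z)
    {t s s₁ : E → F} {T S S₁ : E →L[ℝ] F} (ht : HasFDerivWithinAt t T {v | 0 ≤ ℓ v} z)
    (hs : HasFDerivWithinAt s S {v | 0 ≤ ℓ v} z) (hs₁ : HasFDerivWithinAt s₁ S₁ {v | 0 ≤ ℓ v} a)
    {f : E → F'} {f' : E →L[ℝ] F'} (hf : HasFDerivWithinAt f f' {v | 0 ≤ ℓ v} a)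
    {Ξ : E → F'} {Ξ' : E →L[ℝ] F'} (hΞ : HasFDerivWithinAt Ξ Ξ' B z)
    (hγA : ∀ᶠ r in 𝓝[≥] (0 : ℝ), γ r ∈ A ∧ 0 ≤ ℓ (γ r))
    (hev : ∀ᶠ v in 𝓝[A] a, 0 ≤ ℓ (Λ v) ∧ Λ v ∈ B ∧ t (Λ v) = t z ∧ s (Λ v) = s₁ v ∧
      Ξ (Λ v) = f v) :
    (ℓ z = 0 → 0 ≤ ℓ (L w)) ∧ T (L w) = 0 ∧ S (L w) = S₁ w ∧ Ξ' (L w) = f' w := by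
  have htend : Filter.Tendsto γ (𝓝[≥] 0) (𝓝[A] a) :=
    tendsto_nhdsWithin_of_tendsto_nhds_of_eventually_within _
      (by simpa [ContinuousWithinAt, hγ0] using hγ.continuousWithinAt) (hγA.mono fun _ h => h.1)
  have hev' := htend.eventually hev
  have hΛγ : HasDerivWithinAt (fun r => Λ (γ r)) (L w) (Ici 0) 0 :=
    hΛ.comp_curve hγ hγ0 (hγA.mono fun _ h => h.1)
  have h0 : Λ (γ 0) = z := by rw [hγ0, hΛa]
  have hQ : ∀ᶠ r in 𝓝[≥] (0 : ℝ), Λ (γ r) ∈ {v | 0 ≤ ℓ v} := hev'.mono fun _ h => h.1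
  have hQ' : ∀ᶠ r in 𝓝[≥] (0 : ℝ), γ r ∈ {v | 0 ≤ ℓ v} := hγA.mono fun _ h => h.2
  refine ⟨fun hz => ?_, ?_, ?_, ?_⟩
  · exact (ℓ.hasFDerivAt.hasFDerivWithinAt.comp_curve (A := univ) hΛγ h0
      (by simp)).nonneg_of_eventually (by rw [h0, hz]) hQ
  · exact (ht.comp_curve hΛγ h0 hQ).unique_of_eventuallyEq (hasDerivWithinAt_const 0 _ (t z))
      (hev'.mono fun _ h => h.2.2.1)
  · exact (hs.comp_curve hΛγ h0 hQ).unique_of_eventuallyEq (hs₁.comp_curve hγ hγ0 hQ')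
      (hev'.mono fun _ h => h.2.2.2.1)
  · exact (hΞ.comp_curve hΛγ h0 (hev'.mono fun _ h => h.2.1)).unique_of_eventuallyEq
      (hf.comp_curve hγ hγ0 hQ') (hev'.mono fun _ h => h.2.2.2.2)

end Curves

/-- Linear algebra of translations: the kernels at the unit and at the translated point agree. -/
theorem translation_kernels {E F : Type*} [AddCommGroup E] [Module ℝ E] [FiniteDimensional ℝ E]
    [AddCommGroup F] [Module ℝ F] (ℓ : E →ₗ[ℝ] ℝ) (L : E →ₗ[ℝ] E)
    {T S T₁ S₁ : E →ₗ[ℝ] F} (a z : E)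
    (hL : ∀ w, T₁ w = 0 → (ℓ a = 0 → 0 ≤ ℓ w) →
      (ℓ z = 0 → 0 ≤ ℓ (L w)) ∧ T (L w) = 0 ∧ S (L w) = S₁ w ∧ (L w = 0 → w = 0))
    (hT : Function.Surjective T) (hT₁ : Function.Surjective T₁)
    (hbd : ℓ ≠ 0 → ℓ z = 0 → ∃ v, T v = 0 ∧ ℓ v ≠ 0) :
    Module.finrank ℝ ↥(LinearMap.ker S ⊓ LinearMap.ker T) =
      Module.finrank ℝ ↥(LinearMap.ker S₁ ⊓ LinearMap.ker T₁) ∧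
    (ℓ ≠ 0 → ℓ z = 0 → (LinearMap.ker S ⊓ LinearMap.ker T ≤ LinearMap.ker ℓ ↔
      LinearMap.ker S₁ ⊓ LinearMap.ker T₁ ≤ LinearMap.ker ℓ)) := by
  have hlin : ∀ w, T₁ w = 0 → T (L w) = 0 ∧ S (L w) = S₁ w ∧ (L w = 0 → w = 0) := by
    intro w hw
    rcases le_total 0 (ℓ w) with h | h
    · exact (hL w hw fun _ => h).2
    · have := (hL (-w) (by simp [hw]) fun _ => by simpa using h).2
      simpa using this
  have hdim : Module.finrank ℝ (LinearMap.ker T₁) = Module.finrank ℝ (LinearMap.ker T) := by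
    have h1 := T.finrank_range_add_finrank_ker
    have h2 := T₁.finrank_range_add_finrank_ker
    rw [LinearMap.range_eq_top.2 hT] at h1
    rw [LinearMap.range_eq_top.2 hT₁] at h2
    omega
  let R : LinearMap.ker T₁ →ₗ[ℝ] LinearMap.ker T :=
    L.restrict fun w hw => (hlin w hw).1
  have hRinj : Function.Injective R := by
    rw [← LinearMap.ker_eq_bot, LinearMap.ker_eq_bot']
    intro w hw
    exact Subtype.ext ((hlin w w.2).2.2 (congrArg Subtype.val hw))
  have hRsurj : Function.Surjective R :=
    (LinearMap.injective_iff_surjective_of_finrank_eq_finrank hdim).1 hRinj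
  have hlift : ∀ v, T v = 0 → ∃ w, T₁ w = 0 ∧ L w = v := fun v hv => by
    obtain ⟨w, hw⟩ := hRsurj ⟨v, hv⟩
    exact ⟨w, w.2, congrArg Subtype.val hw⟩
  have hmap : (LinearMap.ker S₁ ⊓ LinearMap.ker T₁).map L = LinearMap.ker S ⊓ LinearMap.ker T := by
    ext v
    constructor
    · rintro ⟨w, ⟨hw1, hw2⟩, rfl⟩
      exact ⟨(hlin w hw2).2.1.trans hw1, (hlin w hw2).1⟩
    · rintro ⟨hv1, hv2⟩
      obtain ⟨w, hw, rfl⟩ := hlift v hv2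
      exact ⟨w, ⟨(hlin w hw).2.1.symm.trans hv1, hw⟩, rfl⟩
  refine ⟨?_, fun hℓ hz => ?_⟩
  · let R' : ↥(LinearMap.ker S₁ ⊓ LinearMap.ker T₁) →ₗ[ℝ] ↥(LinearMap.ker S ⊓ LinearMap.ker T) :=
      L.restrict fun w hw => hmap.le ⟨w, hw, rfl⟩
    refine (LinearEquiv.ofBijective R' ⟨?_, ?_⟩).finrank_eq.symm
    · rw [← LinearMap.ker_eq_bot, LinearMap.ker_eq_bot']
      intro w hw
      exact Subtype.ext ((hlin w w.2.2).2.2 (congrArg Subtype.val hw))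
    · rintro ⟨v, hv⟩
      obtain ⟨w, hw, rfl⟩ := hmap.ge hv
      exact ⟨⟨w, hw⟩, rfl⟩
  · obtain ⟨v₀, hv₀, hv₀ℓ⟩ := hbd hℓ hz
    obtain ⟨w₀, hw₀, rfl⟩ := hlift v₀ hv₀
    have ha : ℓ a = 0 := by
      by_contra ha
      have h1 := (hL w₀ hw₀ fun h => absurd h ha).1 hz
      have h2 := (hL (-w₀) (by simp [hw₀]) fun h => absurd h ha).1 hz
      rw [map_neg, map_neg] at h2
      exact hv₀ℓ (le_antisymm (by linarith) h1)
    have hzero : ∀ w, T₁ w = 0 → ℓ w = 0 → ℓ (L w) = 0 := fun w hw hw0 => by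
      have h1 := (hL w hw fun _ => hw0.ge).1 hz
      have h2 := (hL (-w) (by simp [hw]) fun _ => by simp [hw0]).1 hz
      rw [map_neg, map_neg] at h2
      exact le_antisymm (by linarith) h1
    have hw₀ℓ : ℓ w₀ ≠ 0 := fun h => hv₀ℓ (hzero w₀ hw₀ h)
    have hiff : ∀ w, T₁ w = 0 → (ℓ (L w) = 0 ↔ ℓ w = 0) := by
      refine fun w hw => ⟨fun h => ?_, hzero w hw⟩
      have h1 := hzero (w - (ℓ w / ℓ w₀) • w₀) (by simp [hw, hw₀]) (by simp [hw₀ℓ])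
      rw [map_sub, map_sub, h, map_smul, map_smul, zero_sub, neg_eq_zero, smul_eq_mul,
        mul_eq_zero] at h1
      simpa [hw₀ℓ, hv₀ℓ] using h1
    rw [← hmap]
    constructor
    · intro h w hw
      exact (hiff w hw.2).1 (h ⟨w, hw, rfl⟩)
    · rintro h _ ⟨w, hw, rfl⟩
      exact (hiff w hw.2).2 (h hw)

/-! ### Smooth maps read in preferred charts -/

section ChartDeriv

variable {E : Type*} [NormedAddCommGroup E] [NormedSpace ℝ E]
    {H : Type*} [TopologicalSpace H] {I : ModelWithCorners ℝ E H}
    {E' : Type*} [NormedAddCommGroup E'] [NormedSpace ℝ E']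
    {H' : Type*} [TopologicalSpace H'] {J : ModelWithCorners ℝ E' H'}
    {M : Type*} [TopologicalSpace M] [ChartedSpace H M]
    {N : Type*} [TopologicalSpace N] [ChartedSpace H' N]

theorem IsBoundaryModel.exists_range_eq (h : IsBoundaryModel I) :
    ∃ ℓ : E →L[ℝ] ℝ, range I = {v | 0 ≤ ℓ v} := by
  rcases h with h | ⟨ℓ, -, h⟩
  · exact ⟨0, by simp [h]⟩
  · exact ⟨ℓ, h⟩

variable (I J) in
/-- The derivative of `f`, read in the preferred charts at `p` and `f p`, at the point with
coordinates `z`. -/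
noncomputable def chartDeriv (f : M → N) (p : M) (z : E) : E →L[ℝ] E' :=
  fderivWithin ℝ (writtenInExtChartAt I J p f) (range I) z

theorem exists_isOpen_forall_extChartAt_symm_mem {O : Set M} (hO : IsOpen O) {p : M} (hp : p ∈ O) :
    ∃ U : Set E, IsOpen U ∧ extChartAt I p p ∈ U ∧ ∀ z ∈ U, z ∈ range I →
      z ∈ (extChartAt I p).target ∧ (extChartAt I p).symm z ∈ O := by
  refine ⟨I.symm ⁻¹' ((chartAt H p).target ∩ (chartAt H p).symm ⁻¹' O), ?_, ?_, ?_⟩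
  · exact ((chartAt H p).symm.isOpen_inter_preimage hO).preimage I.continuous_symm
  · simp [hp]
  · rintro z ⟨h1, h2⟩ hz
    exact ⟨by rw [extChartAt_target]; exact ⟨h1, hz⟩, h2⟩

theorem exists_isOpen_contDiffOn_writtenInExtChartAt [IsManifold I ∞ M] [IsManifold J ∞ N]
    {f : M → N} (hf : ContMDiff I J ∞ f) (p : M) :
    ∃ U : Set E, IsOpen U ∧ extChartAt I p p ∈ U ∧
      (∀ z ∈ U, z ∈ range I → z ∈ (extChartAt I p).target ∧
        f ((extChartAt I p).symm z) ∈ (chartAt H' (f p)).source) ∧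
      ContDiffOn ℝ ∞ (writtenInExtChartAt I J p f) (range I ∩ U) := by
  obtain ⟨U, hU, hpU, h⟩ := exists_isOpen_forall_extChartAt_symm_mem (I := I)
    ((chartAt H' (f p)).open_source.preimage hf.continuous) (mem_chart_source H' (f p))
  refine ⟨U, hU, hpU, h, ?_⟩
  rw [← contMDiffOn_iff_contDiffOn]
  refine (contMDiffOn_extChartAt (x := f p)).comp
    ((hf.contMDiffOn (s := univ)).comp ((contMDiffOn_extChartAt_symm p).mono
      fun z hz => (h z hz.2 hz.1).1) fun _ _ => mem_univ _) fun z hz => (h z hz.2 hz.1).2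

theorem hasFDerivWithinAt_chartDeriv {f : M → N} {p : M} {U : Set E} (hU : IsOpen U)
    (hf : ContDiffOn ℝ ∞ (writtenInExtChartAt I J p f) (range I ∩ U)) {z : E} (hz : z ∈ U)
    (hzI : z ∈ range I) :
    HasFDerivWithinAt (writtenInExtChartAt I J p f) (chartDeriv I J f p z) (range I) z :=
  ((differentiableWithinAt_inter (hU.mem_nhds hz)).1
    (hf.differentiableOn (by simp) z ⟨hzI, hz⟩)).hasFDerivWithinAt

theorem chartDeriv_eq_mfderiv {f : M → N} {p : M} (hf : MDifferentiableAt I J f p) (v : E) :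
    chartDeriv I J f p (extChartAt I p p) v = mfderiv I J f p v := by
  rw [hf.mfderiv]; rfl

theorem writtenInExtChartAt_eq_iff {f : M → N} {p : M} {z : E}
    (hz : f ((extChartAt I p).symm z) ∈ (chartAt H' (f p)).source) :
    writtenInExtChartAt I J p f z = writtenInExtChartAt I J p f (extChartAt I p p) ↔
      f ((extChartAt I p).symm z) = f p := by
  simp only [writtenInExtChartAt, Function.comp_apply, extChartAt_to_inv]
  refine ⟨fun h => (extChartAt J (f p)).injOn ?_ (mem_extChartAt_source (f p)) h,
    fun h => by rw [h]⟩
  rwa [extChartAt_source]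

theorem mem_frontier_halfSpace {ℓ : E →L[ℝ] ℝ} (hℓ : ℓ ≠ 0) {a : E} (ha : ℓ a = 0) :
    a ∈ frontier {v | 0 ≤ ℓ v} := by
  refine ⟨subset_closure ha.ge, fun hint => ?_⟩
  obtain ⟨e, he⟩ := exists_inward ℓ
  replace he := he.resolve_left hℓ
  have hc : ContinuousAt (fun r : ℝ => a - r • e) 0 := by fun_prop
  have h1 : ∀ᶠ r in 𝓝 (0 : ℝ), a - r • e ∈ {v | 0 ≤ ℓ v} :=
    hc.eventually_mem (by simpa using mem_interior_iff_mem_nhds.1 hint)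
  obtain ⟨r, hr, hr0⟩ := ((h1.filter_mono (nhdsWithin_le_nhds (s := Ioi (0 : ℝ)))).and
    self_mem_nhdsWithin).exists
  have : 0 ≤ ℓ (a - r • e) := hr
  simp [ha, he] at this
  exact absurd hr0 (not_lt.2 this)

theorem exists_chartDeriv_eq {ℓ : E →L[ℝ] ℝ} (hI : range I = {v | 0 ≤ ℓ v}) {f : M → N}
    (hf : IsSmoothSubmersion I J f) (hb : IsSubmersionOnBoundary I J f) (p : M) (w : E') :
    ∃ v, (ℓ (extChartAt I p p) = 0 → ℓ v = 0) ∧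
      chartDeriv I J f p (extChartAt I p p) v = w := by
  have hd : MDifferentiableAt I J f p := (hf.1 p).mdifferentiableAt (by simp)
  by_cases h : ℓ ≠ 0 ∧ ℓ (extChartAt I p p) = 0
  · obtain ⟨v, hv, hvw⟩ := hb ℓ h.1 hI p (by
      change extChartAt I p p ∈ frontier (range I)
      rw [hI]; exact mem_frontier_halfSpace h.1 h.2) w
    exact ⟨v, fun _ => hv, (chartDeriv_eq_mfderiv hd v).trans hvw⟩
  · obtain ⟨v, hv⟩ := hf.2 p w
    refine ⟨v, fun h0 => ?_, (chartDeriv_eq_mfderiv hd v).trans hv⟩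
    have : ℓ = 0 := by
      by_contra hne
      exact h ⟨hne, h0⟩
    rw [this]
    rfl

end ChartDeriv

/-! ### Translations in Lie categories -/

namespace CategoryStructure

variable {C X : Type*} {𝒞 : CategoryStructure C X}

theorem compMap_of_composable {g h : C} (e : 𝒞.src g = 𝒞.tgt h) :
    𝒞.compMap (g, h) = 𝒞.comp g h e := dif_pos e

theorem compMap_unit_src (g : C) : 𝒞.compMap (g, 𝒞.unit (𝒞.src g)) = g := by
  rw [compMap_of_composable (𝒞.tgt_unit _).symm]
  exact 𝒞.comp_unit g

theorem src_compMap {g h : C} (e : 𝒞.src g = 𝒞.tgt h) : 𝒞.src (𝒞.compMap (g, h)) = 𝒞.src h := by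
  rw [compMap_of_composable e]; exact 𝒞.src_comp _ _ _

theorem tgt_compMap {g h : C} (e : 𝒞.src g = 𝒞.tgt h) : 𝒞.tgt (𝒞.compMap (g, h)) = 𝒞.tgt g := by
  rw [compMap_of_composable e]; exact 𝒞.tgt_comp _ _ _

/-- Left division in a groupoid which contains the category. -/
theorem IsFunctorOverId.exists_compMap_eq {G : Type*} {𝒢 : CategoryStructure G X} {F : C → G}
    (hF : 𝒞.IsFunctorOverId 𝒢 F) (h𝒢 : 𝒢.IsGroupoid) (q : C) :
    ∃ g : G, 𝒢.src g = 𝒞.tgt q ∧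
      ∀ h, 𝒞.src q = 𝒞.tgt h → 𝒢.compMap (g, F (𝒞.compMap (q, h))) = F h := by
  obtain ⟨g, e, e', -, he'⟩ := h𝒢 (F q)
  refine ⟨g, e'.trans (hF.tgt_map q), fun h hq => ?_⟩
  have e2 : 𝒢.src (F q) = 𝒢.tgt (F h) := by rw [hF.src_map, hF.tgt_map, hq]
  rw [compMap_of_composable hq, hF.map_comp q h hq,
    compMap_of_composable (e'.trans (𝒢.tgt_comp _ _ e2).symm), ← 𝒢.assoc g (F q) (F h) e' e2]
  have e3 : ∀ (u : G) (hu : 𝒢.src u = 𝒢.tgt (F h)), u = 𝒢.unit (𝒢.tgt (F h)) →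
      𝒢.comp u (F h) hu = F h := by
    rintro u hu rfl
    exact 𝒢.unit_comp (F h)
  exact e3 _ _ (by rw [he', e2])

end CategoryStructure

section Translation

variable {E : Type*} [NormedAddCommGroup E] [NormedSpace ℝ E] [FiniteDimensional ℝ E]
    {H : Type*} [TopologicalSpace H] {I : ModelWithCorners ℝ E H} {m : ℕ}
    {C : Type*} [TopologicalSpace C] [ChartedSpace H C]
    {X : Type*} [TopologicalSpace X] [ChartedSpace (EuclideanSpace ℝ (Fin m)) X]
    {𝒞 : CategoryStructure C X}
    {E' : Type*} [NormedAddCommGroup E'] [NormedSpace ℝ E']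
    {H' : Type*} [TopologicalSpace H'] {I' : ModelWithCorners ℝ E' H'}
    {G : Type*} [TopologicalSpace G] [ChartedSpace H' G] {𝒢 : CategoryStructure G X} {F : C → G}

/-- The tangent map of the left translation by `q`, read in the charts at the unit of the source of
`q` and at `p`. -/
theorem CategoryStructure.IsLieCategory.exists_translation_tangent (h𝒞 : 𝒞.IsLieCategory I m)
    (h𝒢 : 𝒢.IsLieCategory I' m) (hg : 𝒢.IsGroupoid) (hF : 𝒞.IsFunctorOverId 𝒢 F)
    (hFi : IsSmoothImmersion I I' F) {ℓ : E →L[ℝ] ℝ} (hI : range I = {v | 0 ≤ ℓ v})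
    {x : X} {p q : C} (hp : 𝒞.src p = x) (hq : 𝒞.src q = x)
    (hqp : q ∈ (chartAt H p).source) {S T : E →L[ℝ] EuclideanSpace ℝ (Fin m)}
    (hS : HasFDerivWithinAt (writtenInExtChartAt I (𝓡 m) p 𝒞.src) S (range I) (extChartAt I p q))
    (hT : HasFDerivWithinAt (writtenInExtChartAt I (𝓡 m) p 𝒞.tgt) T (range I)
      (extChartAt I p q)) :
    ∃ L : E →L[ℝ] E, ∀ w,
      chartDeriv I (𝓡 m) 𝒞.tgt (𝒞.unit x) (extChartAt I (𝒞.unit x) (𝒞.unit x)) w = 0 →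
      (ℓ (extChartAt I (𝒞.unit x) (𝒞.unit x)) = 0 → 0 ≤ ℓ w) →
      (ℓ (extChartAt I p q) = 0 → 0 ≤ ℓ (L w)) ∧ T (L w) = 0 ∧
      S (L w) = chartDeriv I (𝓡 m) 𝒞.src (𝒞.unit x) (extChartAt I (𝒞.unit x) (𝒞.unit x)) w ∧
      (L w = 0 → w = 0) := by
  subst hq
  have := h𝒞.isSmoothManifold.isManifold
  have := h𝒞.isSmoothManifold_base.isManifold
  have := h𝒢.isSmoothManifold.isManifold
  set o := 𝒞.unit (𝒞.src q) with ho
  set φ := extChartAt I o with hφ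
  set a := φ o with ha
  have haI : a ∈ range I := mem_range_self _
  have hφa : φ.symm a = o := extChartAt_to_inv o
  obtain ⟨U₁, hU₁, hoU₁, hch₁, hsm₁⟩ :=
    exists_isOpen_contDiffOn_writtenInExtChartAt h𝒞.tgt_submersion.1 o
  obtain ⟨U₂, hU₂, hoU₂, hch₂, hsm₂⟩ :=
    exists_isOpen_contDiffOn_writtenInExtChartAt h𝒞.src_submersion.1 o
  obtain ⟨U₃, hU₃, hoU₃, hch₃, hsm₃⟩ :=
    exists_isOpen_contDiffOn_writtenInExtChartAt hFi.1 o
  have hs₁ := hasFDerivWithinAt_chartDeriv hU₂ hsm₂ hoU₂ haI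
  have hf := hasFDerivWithinAt_chartDeriv hU₃ hsm₃ hoU₃ haI
  let A : Set E := {v | v ∈ U₁ ∧ v ∈ range I ∧
    writtenInExtChartAt I (𝓡 m) o 𝒞.tgt v = writtenInExtChartAt I (𝓡 m) o 𝒞.tgt a}
  have hA : ∀ v ∈ A, v ∈ φ.target ∧ 𝒞.src q = 𝒞.tgt (φ.symm v) := by
    rintro v ⟨hv, hvI, hvt⟩
    obtain ⟨h1, h2⟩ := hch₁ v hv hvI
    refine ⟨h1, ?_⟩
    rw [(writtenInExtChartAt_eq_iff h2).1 hvt, ho, 𝒞.tgt_unit]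
  have haA : a ∈ A := ⟨hoU₁, haI, rfl⟩
  -- the left translation
  have hpair : ContMDiffOn 𝓘(ℝ, E) (I.prod I) ∞ (fun v => (q, φ.symm v)) A :=
    contMDiffOn_const.prodMk ((contMDiffOn_extChartAt_symm o).mono fun v hv => (hA v hv).1)
  have htr : ContMDiffOn 𝓘(ℝ, E) I ∞ (fun v => 𝒞.compMap (q, φ.symm v)) A :=
    h𝒞.comp_smooth.comp hpair fun v hv => (hA v hv).2
  have htra : 𝒞.compMap (q, φ.symm a) = q := by rw [hφa, ho, 𝒞.compMap_unit_src]
  have hΛ : DifferentiableWithinAt ℝ (fun v => extChartAt I p (𝒞.compMap (q, φ.symm v))) A a := by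
    have h1 : ContMDiffAt I 𝓘(ℝ, E) ∞ (extChartAt I p) (𝒞.compMap (q, φ.symm a)) := by
      rw [htra]; exact contMDiffAt_extChartAt' hqp
    have h2 := h1.comp_contMDiffWithinAt a (htr a haA)
    exact h2.contDiffWithinAt.differentiableWithinAt (by simp)
  -- the left division in the groupoid
  obtain ⟨g, hgq, hdiv⟩ := hF.exists_compMap_eq hg q
  let B : Set E := {ζ | ζ ∈ (extChartAt I p).target ∧
    𝒞.tgt ((extChartAt I p).symm ζ) = 𝒞.tgt q}
  set z := extChartAt I p q with hz
  have hqs : q ∈ (extChartAt I p).source := by rwa [extChartAt_source]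
  have hzq : (extChartAt I p).symm z = q := (extChartAt I p).left_inv hqs
  have hzB : z ∈ B := ⟨(extChartAt I p).map_source hqs, by rw [hzq]⟩
  have hpair' : ContMDiffOn 𝓘(ℝ, E) (I'.prod I') ∞
      (fun ζ => (g, F ((extChartAt I p).symm ζ))) B :=
    contMDiffOn_const.prodMk ((hFi.1.contMDiffOn (s := univ)).comp
      ((contMDiffOn_extChartAt_symm p).mono fun ζ hζ => hζ.1) fun _ _ => mem_univ _)
  have hdv : ContMDiffOn 𝓘(ℝ, E) I' ∞
      (fun ζ => 𝒢.compMap (g, F ((extChartAt I p).symm ζ))) B :=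
    h𝒢.comp_smooth.comp hpair' fun ζ hζ => by
      change 𝒢.src g = 𝒢.tgt (F _)
      rw [hgq, hF.tgt_map, hζ.2]
  have hdvz : 𝒢.compMap (g, F ((extChartAt I p).symm z)) = F o := by
    rw [hzq]
    have := hdiv o (𝒞.tgt_unit _).symm
    rwa [ho, 𝒞.compMap_unit_src] at this
  have hΞ : DifferentiableWithinAt ℝ
      (fun ζ => extChartAt I' (F o) (𝒢.compMap (g, F ((extChartAt I p).symm ζ)))) B z := by
    have h1 : ContMDiffAt I' 𝓘(ℝ, E') ∞ (extChartAt I' (F o))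
        (𝒢.compMap (g, F ((extChartAt I p).symm z))) := by
      rw [hdvz]; exact contMDiffAt_extChartAt
    have h2 := h1.comp_contMDiffWithinAt z (hdv z hzB)
    exact h2.contDiffWithinAt.differentiableWithinAt (by simp)
  have hev : ∀ᶠ v in 𝓝[A] a, 0 ≤ ℓ (extChartAt I p (𝒞.compMap (q, φ.symm v))) ∧
      extChartAt I p (𝒞.compMap (q, φ.symm v)) ∈ B ∧
      writtenInExtChartAt I (𝓡 m) p 𝒞.tgt (extChartAt I p (𝒞.compMap (q, φ.symm v))) =
        writtenInExtChartAt I (𝓡 m) p 𝒞.tgt z ∧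
      writtenInExtChartAt I (𝓡 m) p 𝒞.src (extChartAt I p (𝒞.compMap (q, φ.symm v))) =
        writtenInExtChartAt I (𝓡 m) o 𝒞.src v ∧
      extChartAt I' (F o) (𝒢.compMap (g, F ((extChartAt I p).symm
        (extChartAt I p (𝒞.compMap (q, φ.symm v)))))) = writtenInExtChartAt I I' o F v := by
    have hc : ∀ᶠ v in 𝓝[A] a, 𝒞.compMap (q, φ.symm v) ∈ (chartAt H p).source :=
      (htr a haA).continuousWithinAt.eventually_mem
        ((chartAt H p).open_source.mem_nhds 
          (show 𝒞.compMap (q, φ.symm a) ∈ _ by rwa [htra]))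
    filter_upwards [hc, self_mem_nhdsWithin] with v hv hvA
    have hvq := (hA v hvA).2
    have hvs : 𝒞.compMap (q, φ.symm v) ∈ (extChartAt I p).source := by rwa [extChartAt_source]
    have hinv := (extChartAt I p).left_inv hvs
    have hso : 𝒞.src o = 𝒞.src p := by rw [ho, 𝒞.src_unit, hp]
    refine ⟨hI.subset (mem_range_self _), ⟨(extChartAt I p).map_source hvs, ?_⟩, ?_, ?_, ?_⟩
    · rw [hinv, 𝒞.tgt_compMap hvq]
    · simp only [writtenInExtChartAt, Function.comp_apply]
      rw [hinv, hzq, 𝒞.tgt_compMap hvq]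
    · simp only [writtenInExtChartAt, Function.comp_apply]
      rw [hinv, hso, 𝒞.src_compMap hvq]
    · simp only [writtenInExtChartAt, Function.comp_apply]
      rw [hinv, hdiv _ hvq]
  rw [hI] at hS hT hs₁ hf hsm₁
  refine ⟨fderivWithin ℝ (fun v => extChartAt I p (𝒞.compMap (q, φ.symm v))) A a,
    fun w hw hwℓ => ?_⟩
  have hsurj := exists_chartDeriv_eq hI h𝒞.tgt_submersion h𝒞.tgt_submersion_boundary o
  simp only [chartDeriv, hI] at hw hsurj
  obtain ⟨γ, hγ0, hγ, hγev⟩ := exists_curve_in_fiber ℓ hU₁ (hI.subset haI) hoU₁ hsm₁ hsurj hw hwℓ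
  obtain ⟨h1, h2, h3, h4⟩ := translation_tangent_apply ℓ hγ0 hγ hΛ.hasFDerivWithinAt
    (by simp only [htra, hz]) hT hS hs₁ hf hΞ.hasFDerivWithinAt
    (hγev.mono fun r hr => ⟨⟨hr.1, hI.symm.subset hr.2.1, hr.2.2⟩, hr.2.1⟩) hev
  refine ⟨h1, h2, h3, fun h0 => ?_⟩
  rw [h0, map_zero] at h4
  have hd : MDifferentiableAt I I' F o := (hFi.1 o).mdifferentiableAt (by simp)
  have h5 := chartDeriv_eq_mfderiv hd w
  rw [← ha, ← h4] at h5
  exact hFi.2 o (h5.symm.trans (map_zero (mfderiv I I' F o)).symm)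

end Translation

namespace CategoryStructure

variable {E : Type*} [NormedAddCommGroup E] [NormedSpace ℝ E]
    {H : Type*} [TopologicalSpace H] {I : ModelWithCorners ℝ E H} {m : ℕ}
    {C : Type*} [TopologicalSpace C] [ChartedSpace H C]
    {X : Type*} [TopologicalSpace X] [ChartedSpace (EuclideanSpace ℝ (Fin m)) X]
    {𝒞 : CategoryStructure C X}

theorem IsLieCategory.isClosed_homSet (h𝒞 : 𝒞.IsLieCategory I m) (x y : X) :
    IsClosed (𝒞.homSet x y) := by
  have := h𝒞.isSmoothManifold_base.t2Space
  exact (isClosed_singleton.preimage h𝒞.src_submersion.1.continuous).inter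
    (isClosed_singleton.preimage h𝒞.tgt_submersion.1.continuous)

/-- The sets of morphisms of a Lie category extendable to a Lie groupoid are embedded
submanifolds. -/
theorem IsLieCategory.isEmbeddedSubmanifold_homSet (h𝒞 : 𝒞.IsLieCategory I m)
    (hext : IsExtendable.{w} I m 𝒞) (x y : X) : IsEmbeddedSubmanifold I (𝒞.homSet x y) := by
  obtain ⟨E', _, _, H', _, I', G, _, _, 𝒢, F, h𝒢, hg, hF, -, hFi⟩ := hext
  have := h𝒞.isSmoothManifold.finiteDimensional
  have := h𝒞.isSmoothManifold.isManifold
  have := h𝒞.isSmoothManifold.t2Space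
  have := h𝒞.isSmoothManifold.secondCountable
  have := h𝒞.isSmoothManifold_base.isManifold
  obtain ⟨ℓ, hI⟩ := h𝒞.isSmoothManifold.boundaryModel.exists_range_eq
  set o := 𝒞.unit x with ho
  set a := extChartAt I o o with ha
  let K₁ : Submodule ℝ E :=
    LinearMap.ker (chartDeriv I (𝓡 m) 𝒞.src o a : E →ₗ[ℝ] EuclideanSpace ℝ (Fin m)) ⊓
      LinearMap.ker (chartDeriv I (𝓡 m) 𝒞.tgt o a : E →ₗ[ℝ] EuclideanSpace ℝ (Fin m))
  have hT₁ : Function.Surjective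
      (chartDeriv I (𝓡 m) 𝒞.tgt o a : E →ₗ[ℝ] EuclideanSpace ℝ (Fin m)) := fun w =>
    let ⟨v, _, hv⟩ := exists_chartDeriv_eq hI h𝒞.tgt_submersion h𝒞.tgt_submersion_boundary o w
    ⟨v, hv⟩
  refine isEmbeddedSubmanifold_of_submodule hI (Module.finrank ℝ K₁) fun p hp => ?_
  obtain ⟨U₁, hU₁, hpU₁, hch₁, hsm₁⟩ :=
    exists_isOpen_contDiffOn_writtenInExtChartAt h𝒞.src_submersion.1 p
  obtain ⟨U₂, hU₂, hpU₂, hch₂, hsm₂⟩ :=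
    exists_isOpen_contDiffOn_writtenInExtChartAt h𝒞.tgt_submersion.1 p
  set b := extChartAt I p p with hb
  have hb0 : 0 ≤ ℓ b := hI.subset (mem_range_self _)
  obtain ⟨U₃, hU₃₂, hU₃, hpU₃, hsurj⟩ := exists_nhds_surjective ℓ hU₂ hb0 hpU₂ (hI ▸ hsm₂)
    (by simpa only [chartDeriv, hI] using
      exists_chartDeriv_eq hI h𝒞.tgt_submersion h𝒞.tgt_submersion_boundary p)
  have hS : ∀ z ∈ U₁ ∩ U₃, 0 ≤ ℓ z → HasFDerivWithinAt (writtenInExtChartAt I (𝓡 m) p 𝒞.src)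
      (chartDeriv I (𝓡 m) 𝒞.src p z) (range I) z := fun z hz hz0 =>
    hasFDerivWithinAt_chartDeriv hU₁ hsm₁ hz.1 (hI.symm.subset hz0)
  have hT : ∀ z ∈ U₁ ∩ U₃, 0 ≤ ℓ z → HasFDerivWithinAt (writtenInExtChartAt I (𝓡 m) p 𝒞.tgt)
      (chartDeriv I (𝓡 m) 𝒞.tgt p z) (range I) z := fun z hz hz0 =>
    hasFDerivWithinAt_chartDeriv hU₂ hsm₂ (hU₃₂ hz.2) (hI.symm.subset hz0)
  let Φ : E → EuclideanSpace ℝ (Fin m) × EuclideanSpace ℝ (Fin m) := fun z =>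
    (writtenInExtChartAt I (𝓡 m) p 𝒞.src z, writtenInExtChartAt I (𝓡 m) p 𝒞.tgt z)
  have hΦ : ContDiffOn ℝ ∞ Φ ({v | 0 ≤ ℓ v} ∩ (U₁ ∩ U₃)) := by
    rw [← hI]
    exact (hsm₁.mono fun z hz => ⟨hz.1, hz.2.1⟩).prodMk
      (hsm₂.mono fun z hz => ⟨hz.1, hU₃₂ hz.2.2⟩)
  have hu : UniqueDiffOn ℝ {v : E | 0 ≤ ℓ v} := uniqueDiffOn_convex (convex_halfSpace ℓ)
    (interior_halfSpace_nonempty ℓ)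
  have hD : ∀ z ∈ U₁ ∩ U₃, 0 ≤ ℓ z → fderivWithin ℝ Φ {v | 0 ≤ ℓ v} z =
      (chartDeriv I (𝓡 m) 𝒞.src p z).prod (chartDeriv I (𝓡 m) 𝒞.tgt p z) := fun z hz hz0 => by
    have h1 := (hS z hz hz0).prodMk (hT z hz hz0)
    rw [hI] at h1
    exact h1.fderivWithin (hu z hz0)
  have hker : ∀ z ∈ U₁ ∩ U₃, 0 ≤ ℓ z →
      LinearMap.ker (fderivWithin ℝ Φ {v | 0 ≤ ℓ v} z :
        E →ₗ[ℝ] EuclideanSpace ℝ (Fin m) × EuclideanSpace ℝ (Fin m)) =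
      LinearMap.ker (chartDeriv I (𝓡 m) 𝒞.src p z : E →ₗ[ℝ] EuclideanSpace ℝ (Fin m)) ⊓
        LinearMap.ker (chartDeriv I (𝓡 m) 𝒞.tgt p z : E →ₗ[ℝ] EuclideanSpace ℝ (Fin m)) :=
    fun z hz hz0 => by
      rw [hD z hz hz0]
      exact LinearMap.ker_prod _ _
  have hsrc : ∀ z ∈ U₁ ∩ U₃, 0 ≤ ℓ z →
      ((Φ z).1 = (Φ b).1 ↔ 𝒞.src ((extChartAt I p).symm z) = x) := fun z hz hz0 => by
    rw [← hp.1]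
    exact writtenInExtChartAt_eq_iff (I := I) (J := 𝓡 m) (hch₁ z hz.1 (hI.symm.subset hz0)).2
  have htgt : ∀ z ∈ U₁ ∩ U₃, 0 ≤ ℓ z →
      ((Φ z).2 = (Φ b).2 ↔ 𝒞.tgt ((extChartAt I p).symm z) = y) := fun z hz hz0 => by
    rw [← hp.2]
    exact writtenInExtChartAt_eq_iff (I := I) (J := 𝓡 m) (hch₂ z (hU₃₂ hz.2) (hI.symm.subset hz0)).2
  -- invariance under translations
  have hinv : ∀ z ∈ U₁ ∩ U₃, 0 ≤ ℓ z → (Φ z).1 = (Φ b).1 →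
      Module.finrank ℝ ↥(LinearMap.ker (fderivWithin ℝ Φ {v | 0 ≤ ℓ v} z :
        E →ₗ[ℝ] EuclideanSpace ℝ (Fin m) × EuclideanSpace ℝ (Fin m))) = Module.finrank ℝ K₁ ∧
      (ℓ ≠ 0 → ℓ z = 0 → (LinearMap.ker (fderivWithin ℝ Φ {v | 0 ≤ ℓ v} z :
        E →ₗ[ℝ] EuclideanSpace ℝ (Fin m) × EuclideanSpace ℝ (Fin m)) ≤
        LinearMap.ker (ℓ : E →ₗ[ℝ] ℝ) ↔ K₁ ≤ LinearMap.ker (ℓ : E →ₗ[ℝ] ℝ))) := by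
    intro z hz hz0 hz1
    rw [hker z hz hz0]
    have hzt := (hch₁ z hz.1 (hI.symm.subset hz0)).1
    set q := (extChartAt I p).symm z with hq
    have hqz : extChartAt I p q = z := (extChartAt I p).right_inv hzt
    have hqp : q ∈ (chartAt H p).source := by
      have := (extChartAt I p).map_target hzt
      rwa [extChartAt_source] at this
    obtain ⟨L, hL⟩ := h𝒞.exists_translation_tangent h𝒢 hg hF hFi hI hp.1
      ((hsrc z hz hz0).1 hz1) hqp (by rw [hqz]; exact hS z hz hz0)
      (by rw [hqz]; exact hT z hz hz0)
    rw [hqz] at hL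
    have hsj : ∀ w, ∃ v, (ℓ z = 0 → ℓ v = 0) ∧ chartDeriv I (𝓡 m) 𝒞.tgt p z v = w := by
      simpa only [chartDeriv, hI] using hsurj z hz.2 hz0
    obtain ⟨h1, h2⟩ := translation_kernels (ℓ : E →ₗ[ℝ] ℝ) (L : E →ₗ[ℝ] E) a z hL
      (fun w => let ⟨v, _, hv⟩ := hsj w; ⟨v, hv⟩) hT₁ (fun hℓ hz => by
        obtain ⟨e, he⟩ := exists_inward ℓ
        replace he := he.resolve_left fun h => hℓ (by rw [h]; rfl)
        obtain ⟨v, hv, hve⟩ := hsj (chartDeriv I (𝓡 m) 𝒞.tgt p z e)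
        refine ⟨e - v, ?_, ?_⟩
        · change chartDeriv I (𝓡 m) 𝒞.tgt p z (e - v) = 0
          rw [map_sub, hve, sub_self]
        · change ℓ (e - v) ≠ 0
          rw [map_sub, hv hz, he]; simp)
    exact ⟨h1, fun hℓ => h2 fun h => hℓ (ContinuousLinearMap.ext fun v =>
      LinearMap.congr_fun h v)⟩
  have hbU : b ∈ U₁ ∩ U₃ := ⟨hpU₁, hpU₃⟩
  obtain ⟨e, K, he, heU, hbe, heb, hK, hlevel⟩ := exists_slice_diffeo ℓ (hU₁.inter hU₃) hb0 hbU
    hΦ (Module.finrank ℝ K₁) (K₁ ≤ LinearMap.ker (ℓ : E →ₗ[ℝ] ℝ))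
    (fun z hz hz0 hz1 => (hinv z hz hz0 hz1).1)
    (fun hℓ z hz hz0 hz1 => (hinv z hz hz0.ge hz1).2 hℓ hz0)
    (fun w => by
      obtain ⟨v, hv, hvw⟩ :=
        exists_chartDeriv_eq hI h𝒞.src_submersion h𝒞.src_submersion_boundary p w
      refine ⟨v, hv, ?_⟩
      rw [hD b hbU hb0]
      exact hvw)
  obtain ⟨ψ, hψ, hψs, hψe⟩ := he.exists_chart I hI
    (IsManifold.chart_mem_maximalAtlas (I := I) (n := ∞) p)
  have hpψ : p ∈ ψ.source := by rw [hψs]; exact ⟨mem_chart_source H p, hbe⟩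
  refine ⟨ψ, hψ, K, hpψ, hK, fun q hq => ?_⟩
  rw [hψe q hq, hψe p hpψ]
  change _ ↔ e (extChartAt I p q) - e b ∈ K
  rw [hψs] at hq
  have hz : extChartAt I p q ∈ e.source := hq.2
  have hz0 : 0 ≤ ℓ (extChartAt I p q) := hI.subset (mem_range_self _)
  have hqq : (extChartAt I p).symm (extChartAt I p q) = q :=
    (extChartAt I p).left_inv (by rw [extChartAt_source]; exact hq.1)
  rw [heb, ← hlevel _ hz hz0, Prod.ext_iff, hsrc _ (heU hz) hz0, htgt _ (heU hz) hz0, hqq]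
  rfl

end CategoryStructure

theorem mainTheorem5
    {E : Type*} [NormedAddCommGroup E] [NormedSpace ℝ E]
    {H : Type*} [TopologicalSpace H] (I : ModelWithCorners ℝ E H) {m : ℕ}
    {C : Type*} [TopologicalSpace C] [ChartedSpace H C]
    {X : Type*} [TopologicalSpace X] [ChartedSpace (EuclideanSpace ℝ (Fin m)) X]
    (𝒞 : CategoryStructure C X) (h𝒞 : 𝒞.IsLieCategory I m)
    (hext : CategoryStructure.IsExtendable.{w} I m 𝒞) :
    (∀ x y : X, IsClosed (𝒞.homSet x y) ∧ IsEmbeddedSubmanifold I (𝒞.homSet x y)) ∧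
    ∀ (x : X) (S : EmbeddedSubmanifold I (𝒞.homSet x x)),
      IsLieMonoid S.model (𝒞.homSet x x) :=
  ⟨fun x y => ⟨h𝒞.isClosed_homSet x y, h𝒞.isEmbeddedSubmanifold_homSet hext x y⟩,
    fun x S => CategoryStructure.isLieMonoid_homSet h𝒞 x S⟩
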